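/- Let $F = x^3+y^3+z^3$ be the Fermat cubic in $\mathbb{P}^2(\mathbb{C})$. A point $P$ of the curve $F=0$ is called a \emph{type $9$ point} if it is not a flex and there is an irreducible cubic curve which meets $F=0$ at $P$ with intersection multiplicity $9$. (A flex is a point at which some line meets the curve with multiplicity greater than $2$.) Let $K=\mathbb{Q}(\alpha,\beta)\subset\mathbb{C}$, where $\alpha$ is a cube root of $3$ and $\beta$ is a primitive $9$th root of unity. Then there are exactly $72$ type $9$ points, and each of them has homogeneous coordinates in $K$. Let $I_T \subset K[x,y,z]$ be the homogeneous ideal of the set of these $72$ points. Then $$I_T = (F, Q(x,y)) = (F, Q(x,z)) = (F, Q(y,z)),$$ where \begin{align*} Q(x,y) &= x^{24} + 4x^{21}y^3-17x^{18}y^6-65x^{15}y^9-89x^{12}y^{12}-65x^9y^{15}-17x^6y^{18}+4x^3y^{21}+y^{24} \\ &= (x^9 - 3x^6y^3 - 6x^3y^6 - y^9)(x^6 + x^3y^3 + y^6)(x^9 + 6x^6y^3 + 3x^3y^6 - y^9). \end{align*} Consequently the set of type $9$ points is a complete intersection of type $(3,24)$, both over $K$ and over $\mathbb{C}$: its homogeneous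 ideal (in $K[x,y,z]$, respectively in $\mathbb{C}[x,y,z]$) is generated by a regular sequence of two forms of degrees $3$ and $24$. Moreover, $Q(x,y)$ is a product of $24$ linear forms $a_i x+b_i y$ with $a_i,b_i\in K$. -/

import Mathlib

open MvPolynomial

noncomputable section

namespace FermatTypeNine

/-- The complex projective plane `ℙ²(ℂ)`. -/
abbrev Plane : Type := Projectivization ℂ (Fin 3 → ℂ)

/-- The homogeneous ideal of a point `P = [a : b : c]` of the complex projective plane in
`k[x, y, z]`, where `k` is a coefficient field inside `ℂ`: the polynomials `p` for which
`p(a t, b t, c t) ∈ ℂ[t]` is the zero polynomial, that is, all of whose homogeneous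
components vanish at `P`. -/
def pointIdeal (k : Type*) [Field k] [Algebra k ℂ] (P : Plane) : Ideal (MvPolynomial (Fin 3) k) :=
  RingHom.ker (aeval (fun i => Polynomial.C (P.rep i) * Polynomial.X) :
    MvPolynomial (Fin 3) k →ₐ[k] Polynomial ℂ)

instance pointIdeal_isPrime (k : Type*) [Field k] [Algebra k ℂ] (P : Plane) :
    (pointIdeal k P).IsPrime := by
  unfold pointIdeal
  exact RingHom.ker_isPrime _

/-- The homogeneous ideal, in `k[x, y, z]`, of a set of points of the complex projective plane. -/
def idealOfPoints (k : Type*) [Field k] [Algebra k ℂ] (S : Set Plane) :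
    Ideal (MvPolynomial (Fin 3) k) :=
  ⨅ P ∈ S, pointIdeal k P

/-- The intersection multiplicity at `P` of the plane curves `f = 0` and `g = 0` (for forms
`f`, `g`): the length of the localization of `ℂ[x, y, z] / (f, g)` at the homogeneous prime
ideal of `P`. It is infinite exactly when the curves share a component through `P`. -/
def intersectionMultiplicity (f g : MvPolynomial (Fin 3) ℂ) (P : Plane) : ℕ∞ :=
  Module.length (Localization.AtPrime (pointIdeal ℂ P))
    (Localization.AtPrime (pointIdeal ℂ P) ⧸
      (Ideal.span {f, g}).map
        (algebraMap (MvPolynomial (Fin 3) ℂ) (Localization.AtPrime (pointIdeal ℂ P))))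

/-- `P` is a flex of the smooth plane curve `f = 0`: some line meets the curve at `P` with
multiplicity strictly bigger than `2`. -/
def IsFlex (f : MvPolynomial (Fin 3) ℂ) (P : Plane) : Prop :=
  f ∈ pointIdeal ℂ P ∧
    ∃ l : MvPolynomial (Fin 3) ℂ, l ≠ 0 ∧ l.IsHomogeneous 1 ∧ 2 < intersectionMultiplicity f l P

/-- `P` is a type `9` point of the smooth plane curve `f = 0`: it lies on the curve, it is not
a flex, and there is an irreducible cubic curve meeting `f = 0` at `P` with intersection
multiplicity `9`. -/
def IsTypeNine (f : MvPolynomial (Fin 3) ℂ) (P : Plane) : Prop :=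
  f ∈ pointIdeal ℂ P ∧ ¬ IsFlex f P ∧
    ∃ g : MvPolynomial (Fin 3) ℂ, g.IsHomogeneous 3 ∧ Irreducible g ∧
      intersectionMultiplicity f g P = 9

/-- The Fermat cubic `x³ + y³ + z³`. -/
def fermatCubic (k : Type*) [Field k] : MvPolynomial (Fin 3) k :=
  X 0 ^ 3 + X 1 ^ 3 + X 2 ^ 3

/-- The set of type `9` points of the Fermat cubic. -/
def typeNinePoints : Set Plane := {P | IsTypeNine (fermatCubic ℂ) P}

/-- The binary form `Q(x, y)` of degree `24`. -/
def formQ {R : Type*} [CommRing R] (x y : R) : R :=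
  x ^ 24 + 4 * x ^ 21 * y ^ 3 - 17 * x ^ 18 * y ^ 6 - 65 * x ^ 15 * y ^ 9
    - 89 * x ^ 12 * y ^ 12 - 65 * x ^ 9 * y ^ 15 - 17 * x ^ 6 * y ^ 18
    + 4 * x ^ 3 * y ^ 21 + y ^ 24

/-- The set of points `S` is a complete intersection of type `(a, b)` over `k`: its homogeneous
ideal is generated by a regular sequence of two forms of degrees `a` and `b`. -/
def IsCompleteIntersection (k : Type*) [Field k] [Algebra k ℂ] (S : Set Plane) (a b : ℕ) : Prop :=
  ∃ f g : MvPolynomial (Fin 3) k, f.IsHomogeneous a ∧ g.IsHomogeneous b ∧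
    RingTheory.Sequence.IsRegular (MvPolynomial (Fin 3) k) [f, g] ∧
    idealOfPoints k S = Ideal.span {f, g}

end FermatTypeNine

end

/-! The multiplicity of F with a form at P is an order of vanishing in the local ring at P of the
affine cone over F = 0 (`intersectionMultiplicity_eq_ord`). A point of the curve with a zero
coordinate is a flex. At any other point P = (p : q : r) put t = p³/q³; a linear change of
coordinates turns F into hz² = u²z + 3au²h + buh² - 3a²h³ up to a constant, with a, b polynomials in
t (`aeval_oldCoordinates_fermatCubic`). With z = 1, u is a uniformizer and h is an explicit series
in u.

Cubic forms modulo F have nine coefficients, and contact at least 9 imposes nine linear conditions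
on them (`pow_dvd_cubic_iff`). These have a nonzero solution exactly when a(b² + 24a³) = 0. In that
case the solution has contact exactly 9, and it is irreducible because lines have contact at most 2
and, as b ≠ 0, conics at most 5. Up to a nonzero factor a(b² + 24a³) is Q(p, q), so the type 9
points are the zeros of F and Q (`isTypeNine_iff`).

On F = 0 the form Q takes the same value on each pair of coordinates. As Q(t, 1) has 24 distinct
roots in K (`isSplitting_rootQ`), the points (x : y : 1) have 24 values of y and three values of x
over each, all in K. For the ideal, divide a form by F, monic in x: the remainder has degree at most
2 in x and three zeros over each root, so its coefficients vanish on the 24 lines that make up Q(y,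
z) = 0 (`idealOfPoints_typeNinePoints`). -/

noncomputable section

namespace FermatTypeNine

/-! ### Orders of vanishing when the maximal ideal is principal. -/

section Uniformizer

variable {A : Type*} [CommRing A] [IsLocalRing A] {u : A}

lemma ord_uniformizer (hm : IsLocalRing.maximalIdeal A = Ideal.span {u}) : Ring.ord A u = 1 := by
  have : IsSimpleModule A (A ⧸ Ideal.span {u}) := by
    rw [isSimpleModule_iff_isCoatom, ← hm]
    exact (IsLocalRing.maximalIdeal.isMaximal A).out
  exact Module.length_eq_one _ _

lemma ord_uniformizer_pow [IsDomain A] (hm : IsLocalRing.maximalIdeal A = Ideal.span {u}) (hu : u ≠ 0)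
    (n : ℕ) : Ring.ord A (u ^ n) = n := by
  induction n with
  | zero => simp
  | succ n ih =>
    rw [pow_succ, Ring.ord_mul A (mem_nonZeroDivisors_of_ne_zero hu), ih, ord_uniformizer hm]
    push_cast
    rfl

lemma not_dvd_iff_isUnit (hm : IsLocalRing.maximalIdeal A = Ideal.span {u}) {x : A} :
    ¬ u ∣ x ↔ IsUnit x := by
  rw [← Ideal.mem_span_singleton, ← hm, IsLocalRing.mem_maximalIdeal, mem_nonunits_iff, not_not]

lemma le_ord_iff_dvd [IsDomain A] (hm : IsLocalRing.maximalIdeal A = Ideal.span {u}) (hu : u ≠ 0)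
    (n : ℕ) (g : A) : (n : ℕ∞) ≤ Ring.ord A g ↔ u ^ n ∣ g := by
  constructor
  · intro h
    induction n with
    | zero => simp
    | succ n ih =>
      obtain ⟨k, rfl⟩ := ih (le_trans (by exact_mod_cast n.le_succ) h)
      by_cases hk : u ∣ k
      · rw [pow_succ]
        exact mul_dvd_mul_left _ hk
      · exfalso
        have hk' := (not_dvd_iff_isUnit hm).1 hk
        have h1 : Ring.ord A (u ^ n * k) = n := by
          rw [Ring.ord_mul A hk'.mem_nonZeroDivisors, ord_uniformizer_pow hm hu]
          have : Ring.ord A k = 0 := by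
            rw [Ring.ord, Ideal.span_singleton_eq_top.2 hk']
            exact Module.length_eq_zero
          rw [this, add_zero]
        rw [h1] at h
        have : n + 1 ≤ n := by exact_mod_cast h
        omega
  · intro h
    rw [← ord_uniformizer_pow hm hu n]
    have hle : Ideal.span {g} ≤ Ideal.span {u ^ n} := Ideal.span_singleton_le_span_singleton.2 h
    exact Module.length_le_of_surjective (Submodule.factor hle) (Submodule.factor_surjective hle)

/-- Nonzero constants are units, so the lowest nonzero term of `f` decides the order of `f(u)`. This
allows coefficients to be compared as in a power series. -/
lemma pow_dvd_aeval_iff [IsDomain A] {k : Type*} [Field k] [Algebra k A]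
    (hm : IsLocalRing.maximalIdeal A = Ideal.span {u}) (hu : u ≠ 0)
    (n : ℕ) (f : Polynomial k) : u ^ n ∣ Polynomial.aeval u f ↔ Polynomial.X ^ n ∣ f := by
  constructor
  · intro h
    induction n with
    | zero => simp
    | succ n ih =>
      obtain ⟨g, rfl⟩ := ih (dvd_trans (pow_dvd_pow u n.le_succ) h)
      rw [map_mul, map_pow, Polynomial.aeval_X, pow_succ] at h
      have h1 := (mul_dvd_mul_iff_left (pow_ne_zero n hu)).1 h
      rw [pow_succ]
      refine mul_dvd_mul_left _ (Polynomial.X_dvd_iff.2 ?_)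
      by_contra hc
      have h2 : u ∣ algebraMap k A (g.coeff 0) := by
        have h3 := congrArg (Polynomial.aeval u) (Polynomial.X_mul_divX_add g)
        rw [map_add, map_mul, Polynomial.aeval_X, Polynomial.aeval_C] at h3
        rw [← h3] at h1
        exact (dvd_add_right (dvd_mul_right _ _)).1 h1
      exact (not_dvd_iff_isUnit hm).2 ((isUnit_iff_ne_zero.2 hc).map (algebraMap k A)) h2
  · rintro ⟨g, rfl⟩
    rw [map_mul, map_pow, Polynomial.aeval_X]
    exact dvd_mul_right _ _

end Uniformizer

/-! ### Intersection multiplicity as an order in the local ring of one curve. -/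

section Localization

variable (f : MvPolynomial (Fin 3) ℂ) (P : Plane)

/-- The ideal of the plane curve `f = 0` in the local ring at `P` of `ℂ[x, y, z]`. -/
def localIdeal : Ideal (Localization.AtPrime (pointIdeal ℂ P)) :=
  (Ideal.span {f}).map (algebraMap (MvPolynomial (Fin 3) ℂ)
      (Localization.AtPrime (pointIdeal ℂ P)))

/-- The local ring at `P` of the affine cone over the plane curve `f = 0`. -/
def CurveLocalRing : Type :=
  Localization.AtPrime (pointIdeal ℂ P) ⧸ localIdeal f P

instance : CommRing (CurveLocalRing f P) :=
  inferInstanceAs (CommRing (Localization.AtPrime (pointIdeal ℂ P) ⧸ localIdeal f P))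

instance : Algebra (Localization.AtPrime (pointIdeal ℂ P)) (CurveLocalRing f P) :=
  inferInstanceAs (Algebra (Localization.AtPrime (pointIdeal ℂ P))
    (Localization.AtPrime (pointIdeal ℂ P) ⧸ localIdeal f P))

instance : Algebra ℂ (CurveLocalRing f P) :=
  inferInstanceAs (Algebra ℂ (Localization.AtPrime (pointIdeal ℂ P) ⧸ localIdeal f P))

/-- The quotient map onto the local ring of a curve. -/
def toCurveLocalRing : Localization.AtPrime (pointIdeal ℂ P) →ₐ[ℂ] CurveLocalRing f P :=
  Ideal.Quotient.mkₐ ℂ (localIdeal f P)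

/-- The restriction of polynomials to the local ring of a curve. -/
def restrict : MvPolynomial (Fin 3) ℂ →ₐ[ℂ] CurveLocalRing f P :=
  (toCurveLocalRing f P).comp (IsScalarTower.toAlgHom ℂ (MvPolynomial (Fin 3) ℂ)
    (Localization.AtPrime (pointIdeal ℂ P)))

lemma toCurveLocalRing_surjective : Function.Surjective (toCurveLocalRing f P) :=
  Ideal.Quotient.mk_surjective

lemma toCurveLocalRing_eq_zero_iff {x : Localization.AtPrime (pointIdeal ℂ P)} :
    toCurveLocalRing f P x = 0 ↔ x ∈ localIdeal f P :=
  Ideal.Quotient.eq_zero_iff_mem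

/-- The quotient by `f` and `g` can be taken in two stages, and length does not change when scalars
pass along a surjection. -/
lemma intersectionMultiplicity_eq_ord (g : MvPolynomial (Fin 3) ℂ) :
    intersectionMultiplicity f g P = Ring.ord (CurveLocalRing f P) (restrict f P g) := by
  have h := Module.length_eq_of_surjective (S := Localization.AtPrime (pointIdeal ℂ P))
    (R := CurveLocalRing f P) (M := CurveLocalRing f P ⧸ Ideal.span {restrict f P g})
    (toCurveLocalRing_surjective f P)
  have hJ : Ideal.span {restrict f P g} = ((Ideal.span {g}).map (algebraMap
      (MvPolynomial (Fin 3) ℂ) (Localization.AtPrime (pointIdeal ℂ P)))).map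
      (toCurveLocalRing f P) := by
    rw [Ideal.map_span, Set.image_singleton, Ideal.map_span, Set.image_singleton]
    rfl
  rw [intersectionMultiplicity, Ring.ord, ← h, hJ, Ideal.span_insert, Ideal.map_sup]
  exact (DoubleQuot.quotQuotEquivQuotSupₐ (Localization.AtPrime (pointIdeal ℂ P))
    _ _).toLinearEquiv.length_eq.symm

variable {f P}

lemma restrict_self : restrict f P f = 0 :=
  (toCurveLocalRing_eq_zero_iff f P).2
    (Ideal.mem_map_of_mem _ (Ideal.mem_span_singleton_self f))

lemma isUnit_restrict {g : MvPolynomial (Fin 3) ℂ} (hg : g ∉ pointIdeal ℂ P) :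
    IsUnit (restrict f P g) :=
  (IsLocalization.map_units (Localization.AtPrime (pointIdeal ℂ P))
    (⟨g, hg⟩ : (pointIdeal ℂ P).primeCompl)).map (toCurveLocalRing f P)

lemma disjoint_primeCompl (hf : f ∈ pointIdeal ℂ P) :
    Disjoint ((pointIdeal ℂ P).primeCompl : Set (MvPolynomial (Fin 3) ℂ))
      (Ideal.span {f} : Ideal (MvPolynomial (Fin 3) ℂ)) := by
  rw [Set.disjoint_left]
  intro x hx hx'
  exact hx ((Ideal.span_singleton_le_iff_mem _).2 hf hx')

lemma isDomain_curveLocalRing (hp : Prime f) (hf : f ∈ pointIdeal ℂ P) :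
    IsDomain (CurveLocalRing f P) := by
  have h : (Ideal.span {f}).IsPrime := (Ideal.span_singleton_prime hp.ne_zero).2 hp
  have := IsLocalization.isPrime_of_isPrime_disjoint (pointIdeal ℂ P).primeCompl
    (Localization.AtPrime (pointIdeal ℂ P)) _ h (disjoint_primeCompl hf)
  exact inferInstanceAs (IsDomain (Localization.AtPrime (pointIdeal ℂ P) ⧸ (Ideal.span {f}).map
    (algebraMap (MvPolynomial (Fin 3) ℂ) (Localization.AtPrime (pointIdeal ℂ P)))))

/-- The prime ideal of `f` lies in that of `P`, so inverting elements outside the latter creates no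
new multiples of `f`. -/
lemma restrict_eq_zero_iff (hp : Prime f) (hf : f ∈ pointIdeal ℂ P)
    (g : MvPolynomial (Fin 3) ℂ) : restrict f P g = 0 ↔ f ∣ g := by
  have h : (Ideal.span {f}).IsPrime := (Ideal.span_singleton_prime hp.ne_zero).2 hp
  have h1 := IsLocalization.under_map_of_isPrime_disjoint (pointIdeal ℂ P).primeCompl
    (Localization.AtPrime (pointIdeal ℂ P)) h (disjoint_primeCompl hf)
  rw [← Ideal.mem_span_singleton]
  refine Iff.trans ?_ (SetLike.ext_iff.1 h1 g)
  exact toCurveLocalRing_eq_zero_iff f P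

lemma isLocalRing_curveLocalRing (hp : Prime f) (hf : f ∈ pointIdeal ℂ P) :
    IsLocalRing (CurveLocalRing f P) := by
  have := isDomain_curveLocalRing hp hf
  exact IsLocalRing.of_surjective' (toCurveLocalRing f P).toRingHom
    (toCurveLocalRing_surjective f P)

lemma maximalIdeal_curveLocalRing [IsLocalRing (CurveLocalRing f P)] :
    IsLocalRing.maximalIdeal (CurveLocalRing f P) =
      (pointIdeal ℂ P).map (restrict f P) := by
  have h1 : (IsLocalRing.maximalIdeal (Localization.AtPrime (pointIdeal ℂ P))).map
      (toCurveLocalRing f P) = (pointIdeal ℂ P).map (restrict f P) := by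
    rw [← Localization.AtPrime.map_eq_maximalIdeal]
    exact Ideal.map_map _ (toCurveLocalRing f P).toRingHom
  rw [← h1]
  have hs := toCurveLocalRing_surjective f P
  have hl : IsLocalHom (toCurveLocalRing f P).toRingHom := IsLocalHom.of_surjective _ hs
  rcases Ideal.map_eq_top_or_isMaximal_of_surjective (toCurveLocalRing f P) hs
      (IsLocalRing.maximalIdeal.isMaximal (Localization.AtPrime (pointIdeal ℂ P))) with h2 | h2
  · exfalso
    obtain ⟨x, hx, hx1⟩ := (Ideal.mem_map_iff_of_surjective _ hs).1 ((Ideal.eq_top_iff_one _).1 h2)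
    exact (IsLocalRing.mem_maximalIdeal x).1 hx
      (isUnit_of_map_unit (toCurveLocalRing f P).toRingHom x (hx1 ▸ isUnit_one))
  · exact (IsLocalRing.eq_maximalIdeal h2).symm

end Localization

/-! ### Ideals of points and generators of the maximal ideal. -/

section PointIdeal

variable {k : Type*} [Field k] [Algebra k ℂ]

lemma mem_pointIdeal {P : Plane} {f : MvPolynomial (Fin 3) k} :
    f ∈ pointIdeal k P ↔
      aeval (fun i => Polynomial.C (P.rep i) * Polynomial.X : Fin 3 → Polynomial ℂ) f = 0 :=
  RingHom.mem_ker

lemma aeval_C_mul_X_of_isHomogeneous {σ : Type*} {f : MvPolynomial σ k} {d : ℕ}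
    (hf : f.IsHomogeneous d) (v : σ → ℂ) :
    aeval (fun i => Polynomial.C (v i) * Polynomial.X : σ → Polynomial ℂ) f =
      Polynomial.C (aeval v f) * Polynomial.X ^ d := by
  rw [aeval_def, eval₂_eq, aeval_def, eval₂_eq, map_sum, Finset.sum_mul]
  refine Finset.sum_congr rfl fun m hm => ?_
  have hd : ∑ i ∈ m.support, m i = d := by
    have := hf (mem_support_iff.1 hm)
    rwa [Finsupp.weight_apply, Finsupp.sum, Finset.sum_congr rfl (fun i _ => by
      simp only [Pi.one_apply, smul_eq_mul, mul_one]; rfl)] at this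
  simp only [mul_pow, Finset.prod_mul_distrib, Finset.prod_pow_eq_pow_sum, hd, map_mul, map_prod,
    map_pow]
  rw [IsScalarTower.algebraMap_apply k ℂ (Polynomial ℂ), ← Polynomial.C_eq_algebraMap, mul_assoc]

lemma mem_pointIdeal_of_isHomogeneous {P : Plane} {f : MvPolynomial (Fin 3) k} {d : ℕ}
    (hf : f.IsHomogeneous d) : f ∈ pointIdeal k P ↔ aeval P.rep f = 0 := by
  rw [mem_pointIdeal, aeval_C_mul_X_of_isHomogeneous hf, mul_eq_zero, Polynomial.C_eq_zero,
    or_iff_left (pow_ne_zero d Polynomial.X_ne_zero)]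

/-- Modulo these linear forms every variable is a multiple of `X j`, so the quotient map factors
through restriction to the line of `P` in the cone. -/
lemma pointIdeal_eq_span {P : Plane} {j : Fin 3} (hj : P.rep j ≠ 0) :
    pointIdeal ℂ P = Ideal.span (Set.range fun i : Fin 3 =>
      (X i - C (P.rep i / P.rep j) * X j : MvPolynomial (Fin 3) ℂ)) := by
  apply le_antisymm
  · intro f hf
    set I := Ideal.span (Set.range fun i : Fin 3 =>
      (X i - C (P.rep i / P.rep j) * X j : MvPolynomial (Fin 3) ℂ)) with hI
    have h1 : (Ideal.Quotient.mkₐ ℂ I) = ((Ideal.Quotient.mkₐ ℂ I).comp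
        (Polynomial.aeval (C (P.rep j)⁻¹ * X j : MvPolynomial (Fin 3) ℂ))).comp
        (aeval (fun i => Polynomial.C (P.rep i) * Polynomial.X : Fin 3 → Polynomial ℂ)) := by
      apply MvPolynomial.algHom_ext
      intro i
      simp only [AlgHom.comp_apply, aeval_X, map_mul, Polynomial.aeval_C, Polynomial.aeval_X]
      rw [← map_mul, ← sub_eq_zero, ← map_mul, ← map_sub, Ideal.Quotient.mkₐ_eq_mk,
        Ideal.Quotient.eq_zero_iff_mem]
      have h2 : (X i - C (P.rep i / P.rep j) * X j : MvPolynomial (Fin 3) ℂ) ∈ I :=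
        Ideal.subset_span (Set.mem_range_self i)
      rwa [div_eq_mul_inv, C_mul, mul_assoc] at h2
    rw [← Ideal.Quotient.eq_zero_iff_mem, ← Ideal.Quotient.mkₐ_eq_mk ℂ, h1, AlgHom.comp_apply,
      mem_pointIdeal.1 hf, map_zero]
  · rw [Ideal.span_le]
    rintro _ ⟨i, rfl⟩
    simp only [SetLike.mem_coe, mem_pointIdeal, map_sub, aeval_X, map_mul, algHom_C]
    rw [← Polynomial.C_eq_algebraMap, ← mul_assoc, ← Polynomial.C_mul, div_mul_cancel₀ _ hj,
      sub_self]

lemma maximalIdeal_curveLocalRing_eq_span {f : MvPolynomial (Fin 3) ℂ} {P : Plane}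
    [IsLocalRing (CurveLocalRing f P)] {j : Fin 3} (hj : P.rep j ≠ 0) :
    IsLocalRing.maximalIdeal (CurveLocalRing f P) = Ideal.span (Set.range fun i : Fin 3 =>
      restrict f P (X i - C (P.rep i / P.rep j) * X j)) := by
  rw [maximalIdeal_curveLocalRing]
  refine (congrArg (Ideal.map (restrict f P)) (pointIdeal_eq_span hj)).trans ?_
  refine (Ideal.map_span (restrict f P) _).trans ?_
  rw [← Set.range_comp]
  rfl

lemma prime_of_isHomogeneous_one {l : MvPolynomial (Fin 3) ℂ} (hl : l.IsHomogeneous 1)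
    (h0 : l ≠ 0) : Prime l := by
  refine (irreducible_of_totalDegree_eq_one (hl.totalDegree h0) fun x hx => ?_).prime
  rw [isUnit_iff_ne_zero]
  rintro rfl
  exact h0 (MvPolynomial.ext _ _ fun m => by simpa using hx m)

end PointIdeal

/-! ### Flexes and primality of the Fermat cubic. -/

section Fermat

lemma isHomogeneous_fermatCubic (k : Type*) [Field k] : (fermatCubic k).IsHomogeneous 3 :=
  ((isHomogeneous_X_pow 0 3).add (isHomogeneous_X_pow 1 3)).add (isHomogeneous_X_pow 2 3)

lemma fermatCubic_mem_pointIdeal (k : Type*) [Field k] [Algebra k ℂ] (P : Plane) :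
    fermatCubic k ∈ pointIdeal k P ↔ P.rep 0 ^ 3 + P.rep 1 ^ 3 + P.rep 2 ^ 3 = 0 := by
  rw [mem_pointIdeal_of_isHomogeneous (isHomogeneous_fermatCubic k)]
  simp [fermatCubic]

lemma finSuccEquiv_fermatCubic (k : Type*) [Field k] : finSuccEquiv k 2 (fermatCubic k) =
    Polynomial.X ^ 3 + Polynomial.C (X 0 ^ 3 + X 1 ^ 3) := by
  simp only [fermatCubic, map_add, map_pow, finSuccEquiv_X_zero]
  rw [show (1 : Fin 3) = Fin.succ 0 from rfl, show (2 : Fin 3) = Fin.succ 1 from rfl,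
    finSuccEquiv_X_succ, finSuccEquiv_X_succ, add_assoc]

/-- The line `X j = s X k` with s³ = -1 passes through `P`, and F restricts to `X i ^ 3` on it,
where `X i` is a uniformizer at `P`. -/
lemma isFlex_of_rep_eq_zero {P : Plane} (hP : fermatCubic ℂ ∈ pointIdeal ℂ P) {i : Fin 3}
    (hi : P.rep i = 0) : IsFlex (fermatCubic ℂ) P := by
  refine ⟨hP, ?_⟩
  obtain ⟨j, k, hij, hik, hjk, hk⟩ : ∃ j k : Fin 3, i ≠ j ∧ i ≠ k ∧ j ≠ k ∧ P.rep k ≠ 0 := by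
    obtain ⟨k, hk⟩ := Function.ne_iff.1 P.rep_nonzero
    have hik : i ≠ k := fun h => hk (h ▸ hi)
    have : ∀ i k : Fin 3, i ≠ k → ∃ j, i ≠ j ∧ j ≠ k := by decide
    obtain ⟨j, h1, h2⟩ := this i k hik
    exact ⟨j, k, h1, hik, h2, hk⟩
  have huniv : (Finset.univ : Finset (Fin 3)) = {i, j, k} := by
    have : ∀ i j k : Fin 3, i ≠ j → i ≠ k → j ≠ k → (Finset.univ : Finset (Fin 3)) = {i, j, k} := by
      decide
    exact this i j k hij hik hjk
  have hF : fermatCubic ℂ = X i ^ 3 + (X j ^ 3 + X k ^ 3) := by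
    have h1 : fermatCubic ℂ = ∑ m : Fin 3, X m ^ 3 := by rw [Fin.sum_univ_three]; rfl
    rw [h1, huniv, Finset.sum_insert (by simp [hij, hik]), Finset.sum_pair hjk]
  set s := P.rep j / P.rep k with hs
  have hs3 : s ^ 3 = -1 := by
    rw [hF, mem_pointIdeal_of_isHomogeneous (hF ▸ isHomogeneous_fermatCubic ℂ)] at hP
    simp only [map_add, map_pow, aeval_X, hi] at hP
    rw [hs, div_pow, div_eq_iff (pow_ne_zero 3 hk)]
    linear_combination hP
  set l : MvPolynomial (Fin 3) ℂ := X j - C s * X k with hl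
  have hlh : l.IsHomogeneous 1 := by
    refine (isHomogeneous_X _ _).sub ?_
    simpa using (isHomogeneous_C (Fin 3) s).mul (isHomogeneous_X ℂ k)
  have hlp : Prime l := by
    refine prime_of_isHomogeneous_one hlh fun h => ?_
    have := congrArg (eval (Pi.single j 1)) h
    simp [hl, hjk.symm] at this
  have hlP : l ∈ pointIdeal ℂ P := by
    rw [mem_pointIdeal_of_isHomogeneous hlh]
    simp [hl, hs, hk]
  refine ⟨l, hlp.ne_zero, hlh, ?_⟩
  -- By symmetry the order can be computed in the local ring of the line instead of that of the
  -- cubic.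
  have hsymm : intersectionMultiplicity (fermatCubic ℂ) l P =
      intersectionMultiplicity l (fermatCubic ℂ) P := by
    rw [intersectionMultiplicity, Set.pair_comm, intersectionMultiplicity]
  rw [hsymm, intersectionMultiplicity_eq_ord]
  have := isDomain_curveLocalRing hlp hlP
  have := isLocalRing_curveLocalRing hlp hlP
  have hm : IsLocalRing.maximalIdeal (CurveLocalRing l P) = Ideal.span {restrict l P (X i)} := by
    rw [maximalIdeal_curveLocalRing_eq_span hk]
    apply le_antisymm
    · rw [Ideal.span_le]
      rintro _ ⟨m, rfl⟩
      have hm := huniv ▸ Finset.mem_univ m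
      simp only [Finset.mem_insert, Finset.mem_singleton] at hm
      rcases hm with rfl | rfl | rfl
      · simp only [hi, zero_div, C_0, zero_mul, sub_zero]
        exact Ideal.mem_span_singleton_self _
      · change restrict l P l ∈ _
        rw [restrict_self]
        exact zero_mem _
      · simp only [div_self hk, C_1, one_mul, sub_self, map_zero]
        exact zero_mem _
    · rw [Ideal.span_singleton_le_iff_mem]
      refine Ideal.subset_span ⟨i, ?_⟩
      simp [hi]
  have hu : restrict l P (X i) ≠ 0 := by
    rw [Ne, restrict_eq_zero_iff hlp hlP]
    rintro ⟨g, hg⟩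
    have := congrArg (eval (Pi.single i 1)) hg
    simp [hl, hij.symm, hik.symm] at this
  have h3 := (le_ord_iff_dvd hm hu 3 (restrict l P (fermatCubic ℂ))).2 ?_
  · exact lt_of_lt_of_le (by norm_num) h3
  · have h4 : fermatCubic ℂ = X i ^ 3 + l * (X j ^ 2 + C s * X j * X k + C s ^ 2 * X k ^ 2) := by
      have : (C s : MvPolynomial (Fin 3) ℂ) ^ 3 = -1 := by rw [← C_pow, hs3]; simp
      rw [hF, hl]
      linear_combination X k ^ 3 * this
    rw [h4, map_add, map_mul, restrict_self, zero_mul, add_zero, map_pow]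

lemma prime_X_add_X : Prime (X 0 + X 1 : MvPolynomial (Fin 2) ℂ) := by
  have h : (finSuccEquiv ℂ 1) (X 0 + X 1) = Polynomial.X - Polynomial.C (-X 0) := by
    rw [map_add, finSuccEquiv_X_zero, show (1 : Fin 2) = Fin.succ 0 from rfl, finSuccEquiv_X_succ,
      map_neg, sub_neg_eq_add]
  rw [← MulEquiv.prime_iff (finSuccEquiv ℂ 1).toMulEquiv]
  change Prime ((finSuccEquiv ℂ 1) (X 0 + X 1))
  rw [h]
  exact Polynomial.prime_X_sub_C _

/-- Eisenstein's criterion in x at the prime y + z, which divides y³ + z³ exactly once. -/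
lemma prime_fermatCubic : Prime (fermatCubic ℂ) := by
  rw [← MulEquiv.prime_iff (finSuccEquiv ℂ 2).toMulEquiv]
  change Prime ((finSuccEquiv ℂ 2) (fermatCubic ℂ))
  rw [finSuccEquiv_fermatCubic]
  apply Irreducible.prime
  have hm : (Polynomial.X ^ 3 + Polynomial.C (X 0 ^ 3 + X 1 ^ 3) :
    Polynomial (MvPolynomial (Fin 2) ℂ)).Monic := Polynomial.monic_X_pow_add_C _ (by norm_num)
  have hd : (Polynomial.X ^ 3 + Polynomial.C (X 0 ^ 3 + X 1 ^ 3) :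
    Polynomial (MvPolynomial (Fin 2) ℂ)).natDegree = 3 := Polynomial.natDegree_X_pow_add_C
  have hp := prime_X_add_X
  refine Polynomial.irreducible_of_eisenstein_criterion
    (P := Ideal.span {(X 0 + X 1 : MvPolynomial (Fin 2) ℂ)})
    ((Ideal.span_singleton_prime hp.ne_zero).2 hp) ?_ ?_ ?_ ?_ hm.isPrimitive
  · rw [hm.leadingCoeff, Ideal.mem_span_singleton]
    exact fun h => hp.not_isUnit (isUnit_of_dvd_one h)
  · intro n hn
    rw [Polynomial.degree_eq_natDegree hm.ne_zero, hd, Nat.cast_lt] at hn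
    rw [Ideal.mem_span_singleton]
    interval_cases n
    · simp only [Polynomial.coeff_add, Polynomial.coeff_X_pow, Polynomial.coeff_C]
      exact ⟨X 0 ^ 2 - X 0 * X 1 + X 1 ^ 2, by simp; ring⟩
    all_goals
      rw [Polynomial.coeff_add, Polynomial.coeff_X_pow, Polynomial.coeff_C]
      simp
  · rw [Polynomial.degree_eq_natDegree hm.ne_zero, hd]
    norm_num
  · rw [Ideal.span_singleton_pow, Ideal.mem_span_singleton]
    simp only [Polynomial.coeff_add, Polynomial.coeff_X_pow, Polynomial.coeff_C]
    rintro ⟨g, hg⟩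
    -- A multiple of (y + z)² has zero derivative at (1, -1), whereas y³ + z³ has derivative 3
    -- there.
    have h3 := congrArg (fun f => eval ![(1 : ℂ), -1] (pderiv 0 f)) hg
    simp [Derivation.leibniz, Derivation.leibniz_pow] at h3

end Fermat

/-! ### The normal form of the cubic at a point. -/

section NormalForm

lemma isHomogeneous_aeval {σ τ k : Type*} [Field k] {g : MvPolynomial σ k} {d : ℕ}
    (hg : g.IsHomogeneous d) {w : σ → MvPolynomial τ k} (hw : ∀ i, (w i).IsHomogeneous 1) :
    (aeval w g).IsHomogeneous d := by
  have := hg.aeval w (n := 1) hw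
  simpa using this

lemma eq_sum_antidiagonalTuple {g : MvPolynomial (Fin 3) ℂ} {d : ℕ} (hg : g.IsHomogeneous d) :
    g = ∑ m ∈ Finset.Nat.antidiagonalTuple 3 d,
      C (coeff (Finsupp.equivFunOnFinite.symm m) g) * (X 0 ^ m 0 * X 1 ^ m 1 * X 2 ^ m 2) := by
  classical
  conv_lhs => rw [as_sum g]
  have hdeg : ∀ m ∈ g.support, m 0 + m 1 + m 2 = d := fun m hm => by
    have := hg (mem_support_iff.1 hm)
    rw [Finsupp.weight_apply, Finsupp.sum_fintype _ _ (by simp), Fin.sum_univ_three] at this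
    simpa using this
  have hmon : ∀ m : Fin 3 →₀ ℕ, monomial m (coeff m g) =
      C (coeff m g) * (X 0 ^ m 0 * X 1 ^ m 1 * X 2 ^ m 2) := fun m => by
    rw [monomial_eq, Finsupp.prod_fintype _ _ (by simp), Fin.prod_univ_three]
  refine Finset.sum_of_injOn (fun m => (m : Fin 3 → ℕ)) DFunLike.coe_injective.injOn ?_ ?_ ?_
  · intro m hm
    rw [Finset.mem_coe, Finset.Nat.mem_antidiagonalTuple, Fin.sum_univ_three]
    exact hdeg m hm
  · intro m _ hm
    have : coeff (Finsupp.equivFunOnFinite.symm m) g = 0 := by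
      by_contra h
      exact hm ⟨_, mem_support_iff.2 h, rfl⟩
    rw [this, C_0, zero_mul]
  · intro m _
    rw [hmon]
    congr 3
    exact (Finsupp.equivFunOnFinite.symm_apply_apply m).symm

/-- The coefficients are ordered by decreasing power of `X 2`, the variable that becomes 1 in local
computations. -/
lemma exists_eq_cubic {g : MvPolynomial (Fin 3) ℂ} (hg : g.IsHomogeneous 3) :
    ∃ c : Fin 10 → ℂ, g = C (c 0) * X 2 ^ 3 + C (c 1) * X 0 * X 2 ^ 2 + C (c 2) * X 1 * X 2 ^ 2 +
      C (c 3) * X 0 ^ 2 * X 2 + C (c 4) * X 0 * X 1 * X 2 + C (c 5) * X 1 ^ 2 * X 2 +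
      C (c 6) * X 0 ^ 3 + C (c 7) * X 0 ^ 2 * X 1 + C (c 8) * X 0 * X 1 ^ 2 +
      C (c 9) * X 1 ^ 3 := by
  have h := eq_sum_antidiagonalTuple hg
  rw [show Finset.Nat.antidiagonalTuple 3 3 = {![0, 0, 3], ![1, 0, 2], ![0, 1, 2], ![2, 0, 1],
    ![1, 1, 1], ![0, 2, 1], ![3, 0, 0], ![2, 1, 0], ![1, 2, 0], ![0, 3, 0]} by decide] at h
  repeat rw [Finset.sum_insert (by decide)] at h
  rw [Finset.sum_singleton] at h
  generalize hf : (fun m : Fin 3 → ℕ => coeff (Finsupp.equivFunOnFinite.symm m) g) = f at h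
  have hf' : ∀ m, coeff (Finsupp.equivFunOnFinite.symm m) g = f m := fun m => by rw [← hf]
  simp only [hf'] at h
  refine ⟨![f ![0, 0, 3], f ![1, 0, 2], f ![0, 1, 2], f ![2, 0, 1],
    f ![1, 1, 1], f ![0, 2, 1], f ![3, 0, 0], f ![2, 1, 0], f ![1, 2, 0], f ![0, 3, 0]], ?_⟩
  rw [h]
  simp
  ring

lemma exists_eq_conic {g : MvPolynomial (Fin 3) ℂ} (hg : g.IsHomogeneous 2) :
    ∃ c : Fin 6 → ℂ, g = C (c 0) * X 2 ^ 2 + C (c 1) * X 0 * X 2 + C (c 2) * X 1 * X 2 +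
      C (c 3) * X 0 ^ 2 + C (c 4) * X 0 * X 1 + C (c 5) * X 1 ^ 2 := by
  have h := eq_sum_antidiagonalTuple hg
  rw [show Finset.Nat.antidiagonalTuple 3 2 = {![0, 0, 2], ![1, 0, 1], ![0, 1, 1], ![2, 0, 0],
    ![1, 1, 0], ![0, 2, 0]} by decide] at h
  repeat rw [Finset.sum_insert (by decide)] at h
  rw [Finset.sum_singleton] at h
  generalize hf : (fun m : Fin 3 → ℕ => coeff (Finsupp.equivFunOnFinite.symm m) g) = f at h
  have hf' : ∀ m, coeff (Finsupp.equivFunOnFinite.symm m) g = f m := fun m => by rw [← hf]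
  simp only [hf'] at h
  refine ⟨![f ![0, 0, 2], f ![1, 0, 1], f ![0, 1, 1], f ![2, 0, 0],
    f ![1, 1, 0], f ![0, 2, 0]], ?_⟩
  rw [h]
  simp
  ring

lemma exists_eq_line {g : MvPolynomial (Fin 3) ℂ} (hg : g.IsHomogeneous 1) :
    ∃ c : Fin 3 → ℂ, g = C (c 0) * X 2 + C (c 1) * X 0 + C (c 2) * X 1 := by
  have h := eq_sum_antidiagonalTuple hg
  rw [show Finset.Nat.antidiagonalTuple 3 1 = {![0, 0, 1], ![1, 0, 0], ![0, 1, 0]} by decide] at h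
  repeat rw [Finset.sum_insert (by decide)] at h
  rw [Finset.sum_singleton] at h
  generalize hf : (fun m : Fin 3 → ℕ => coeff (Finsupp.equivFunOnFinite.symm m) g) = f at h
  have hf' : ∀ m, coeff (Finsupp.equivFunOnFinite.symm m) g = f m := fun m => by rw [← hf]
  simp only [hf'] at h
  refine ⟨![f ![0, 0, 1], f ![1, 0, 0], f ![0, 1, 0]], ?_⟩
  rw [h]
  simp
  ring

/-- The cubic curve `hz² = u²z + 3au²h + buh² - 3a²h³`. -/
def normalCubic (a b : ℂ) : MvPolynomial (Fin 3) ℂ :=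
  X 1 * X 2 ^ 2 - X 0 ^ 2 * X 2 - C (3 * a) * X 0 ^ 2 * X 1 - C b * X 0 * X 1 ^ 2 +
    C (3 * a ^ 2) * X 1 ^ 3

/-- Linear forms that express `x, y, z` in the coordinates adapted to the point `(p, q, r)`
of the Fermat cubic, where `t = p³ / q³`. -/
def oldCoordinates (p q r t : ℂ) : Fin 3 → MvPolynomial (Fin 3) ℂ :=
  let Z := X 2 + C ((t - 1) / 3) * X 0 + C ((t ^ 2 + 7 * t + 1) / 18) * X 1
  let U := X 0 - C ((2 * t + 1) / 3) * X 1
  ![C p * (Z + U), C q * (Z - C (t * (1 + t)) * X 1 - C t * U), C r * Z]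

/-- The linear forms in `x, y, z` that are the coordinates adapted to the point `(p, q, r)`
of the Fermat cubic, where `t = p³ / q³`. -/
def newCoordinates (p q r t : ℂ) : Fin 3 → MvPolynomial (Fin 3) ℂ :=
  let U := C p⁻¹ * X 0 - C r⁻¹ * X 2
  let V := C q⁻¹ * X 1 - C r⁻¹ * X 2
  let H := C (-(t * (1 + t))⁻¹) * (V + C t * U)
  let U' := U + C ((2 * t + 1) / 3) * H
  ![U', H, C r⁻¹ * X 2 - C ((t - 1) / 3) * U' - C ((t ^ 2 + 7 * t + 1) / 18) * H]

variable {p q r t : ℂ}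

lemma isHomogeneous_C_mul {c : ℂ} {g : MvPolynomial (Fin 3) ℂ} {d : ℕ} (hg : g.IsHomogeneous d) :
    (C c * g).IsHomogeneous d := by
  simpa using (isHomogeneous_C (Fin 3) c).mul hg

lemma isHomogeneous_oldCoordinates (i : Fin 3) : (oldCoordinates p q r t i).IsHomogeneous 1 := by
  have h0 := fun i => isHomogeneous_X ℂ (i : Fin 3)
  have hZ : (X 2 + C ((t - 1) / 3) * X 0 + C ((t ^ 2 + 7 * t + 1) / 18) * X 1 :
      MvPolynomial (Fin 3) ℂ).IsHomogeneous 1 :=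
    ((h0 2).add (isHomogeneous_C_mul (h0 0))).add (isHomogeneous_C_mul (h0 1))
  have hU : (X 0 - C ((2 * t + 1) / 3) * X 1 : MvPolynomial (Fin 3) ℂ).IsHomogeneous 1 :=
    (h0 0).sub (isHomogeneous_C_mul (h0 1))
  fin_cases i
  · exact isHomogeneous_C_mul (hZ.add hU)
  · exact isHomogeneous_C_mul ((hZ.sub (isHomogeneous_C_mul (h0 1))).sub (isHomogeneous_C_mul hU))
  · exact isHomogeneous_C_mul hZ

lemma isHomogeneous_newCoordinates (i : Fin 3) : (newCoordinates p q r t i).IsHomogeneous 1 := by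
  have h0 := fun (c : ℂ) i => isHomogeneous_C_mul (c := c) (isHomogeneous_X ℂ (i : Fin 3))
  have hU : (C p⁻¹ * X 0 - C r⁻¹ * X 2 : MvPolynomial (Fin 3) ℂ).IsHomogeneous 1 :=
    (h0 _ 0).sub (h0 _ 2)
  have hV : (C q⁻¹ * X 1 - C r⁻¹ * X 2 : MvPolynomial (Fin 3) ℂ).IsHomogeneous 1 :=
    (h0 _ 1).sub (h0 _ 2)
  have hH := isHomogeneous_C_mul (c := -(t * (1 + t))⁻¹) (hV.add (isHomogeneous_C_mul (c := t) hU))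
  have hU' := hU.add (isHomogeneous_C_mul (c := (2 * t + 1) / 3) hH)
  fin_cases i
  · exact hU'
  · exact hH
  · exact ((h0 _ 2).sub (isHomogeneous_C_mul hU')).sub (isHomogeneous_C_mul hH)

lemma aeval_newCoordinates_oldCoordinates (hp : p ≠ 0) (hq : q ≠ 0) (hr : r ≠ 0)
    (ht : t * (1 + t) ≠ 0) (g : MvPolynomial (Fin 3) ℂ) :
    aeval (newCoordinates p q r t) (aeval (oldCoordinates p q r t) g) = g := by
  have h1 : t ≠ 0 := left_ne_zero_of_mul ht
  have h2 : 1 + t ≠ 0 := right_ne_zero_of_mul ht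
  have h : (aeval (newCoordinates p q r t)).comp (aeval (oldCoordinates p q r t)) =
      AlgHom.id ℂ (MvPolynomial (Fin 3) ℂ) := by
    apply MvPolynomial.algHom_ext
    intro i
    rw [AlgHom.comp_apply, aeval_X, AlgHom.id_apply]
    apply MvPolynomial.funext
    intro x
    fin_cases i <;>
    simp only [oldCoordinates, newCoordinates, algHom_C, algebraMap_eq, map_add, map_sub, map_mul,
      aeval_X, eval_C, eval_X, Fin.zero_eta, Fin.mk_one, Fin.reduceFinMk, Matrix.cons_val] <;>
    field_simp <;> ring
  exact congrArg (fun f => f g) h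

/-- Scaling by p, q, r moves the point to (1 : 1 : 1) and the cubic to tX³ + Y³ - (1 + t)Z³, up to
q³. With U = X - Z and V = Y - Z the tangent is V + tU = 0, which becomes h = 0. The shifts of U and
Z remove the terms uhz, h²z and u³. -/
lemma aeval_oldCoordinates_fermatCubic (hpq : p ^ 3 = t * q ^ 3)
    (hrq : r ^ 3 = - (1 + t) * q ^ 3) :
    aeval (oldCoordinates p q r t) (fermatCubic ℂ) = C (-3 * q ^ 3 * (t * (1 + t))) *
      normalCubic (-(t ^ 2 + t + 1) / 18) ((1 - t) * (2 * t + 1) * (t + 2) / 27) := by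
  apply MvPolynomial.funext
  intro x
  simp only [fermatCubic, normalCubic, oldCoordinates, map_add, map_sub, map_mul, map_pow,
      aeval_X, eval_C, eval_X, Matrix.cons_val, mul_pow]
  rw [hpq, hrq]
  ring

end NormalForm

/-! ### The expansion of h in powers of u. -/

section Expansion

variable {A : Type*} [CommRing A]

/-- The relation gives h = u²k. Substituting the equation for k into itself peels off two
coefficients at a time, with k1, k2, k3 the successive remainders. -/
lemma exists_expansion [IsDomain A] [IsLocalRing A] {u h a b : A} (hu : u ≠ 0)
    (hu' : u ∈ IsLocalRing.maximalIdeal A)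
    (hrel : h = u ^ 2 + 3 * a * u ^ 2 * h + b * u * h ^ 2 - 3 * a ^ 2 * h ^ 3)
    (hh : h ∈ IsLocalRing.maximalIdeal A) :
    ∃ e, h = u ^ 2 + 3 * a * u ^ 4 + b * u ^ 5 + 6 * a ^ 2 * u ^ 6 + 9 * a * b * u ^ 7 +
      (2 * b ^ 2 - 9 * a ^ 3) * u ^ 8 + u ^ 9 * e := by
  -- All terms on the right of the relation except u² are multiples of h; collected on the left they
  -- give h times this unit.
  obtain ⟨v, hv⟩ : IsUnit (1 - (3 * a * u * u + b * u * h - 3 * a ^ 2 * h * h)) := by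
    refine (IsLocalRing.isUnit_or_isUnit_one_sub_self _).resolve_left ?_
    rw [← mem_nonunits_iff, ← IsLocalRing.mem_maximalIdeal]
    exact Ideal.sub_mem _ (Ideal.add_mem _ (Ideal.mul_mem_left _ _ hu') (Ideal.mul_mem_left _ _ hh))
      (Ideal.mul_mem_left _ _ hh)
  obtain ⟨k, rfl⟩ : ∃ k, h = u ^ 2 * k := by
    refine ⟨↑v⁻¹, ?_⟩
    rw [Units.eq_mul_inv_iff_mul_eq, hv]
    linear_combination hrel
  have h0 : k = 1 + 3 * a * u ^ 2 * k + b * u ^ 3 * k ^ 2 - 3 * a ^ 2 * u ^ 4 * k ^ 3 := by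
    apply mul_left_cancel₀ (pow_ne_zero 2 hu)
    linear_combination hrel
  obtain ⟨k1, h1⟩ : ∃ k1, k = 1 + u ^ 2 * k1 ∧
      k1 = 3 * a * k + b * u * k ^ 2 - 3 * a ^ 2 * u ^ 2 * k ^ 3 :=
    ⟨_, by linear_combination h0, rfl⟩
  obtain ⟨rfl, h1⟩ := h1
  obtain ⟨k2, h2⟩ : ∃ k2, k1 = 3 * a + b * u + u ^ 2 * k2 ∧
      k2 = 3 * a * k1 + b * u * (2 * k1 + u ^ 2 * k1 ^ 2) - 3 * a ^ 2 * (1 + u ^ 2 * k1) ^ 3 :=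
    ⟨_, by linear_combination h1, rfl⟩
  obtain ⟨k3, h3⟩ : ∃ k3, k2 = 6 * a ^ 2 + 9 * a * b * u + u ^ 2 * k3 ∧
      k3 = 3 * a * k2 + 2 * b ^ 2 + 2 * b * u * k2 + b * u * k1 ^ 2 -
        3 * a ^ 2 * (3 * k1 + 3 * u ^ 2 * k1 ^ 2 + u ^ 4 * k1 ^ 3) :=
    ⟨_, by linear_combination h2.2 + (3 * a + 2 * b * u) * h2.1, rfl⟩
  refine ⟨3 * a * (9 * a * b + u * k3) + 2 * b * k2 + b * k1 ^ 2 -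
    3 * a ^ 2 * (3 * (b + u * k2) + 3 * u * k1 ^ 2 + u ^ 3 * k1 ^ 3), ?_⟩
  linear_combination u ^ 4 * h2.1 + u ^ 6 * h3.1 + u ^ 8 * h3.2 + 3 * a * u ^ 8 * h3.1 -
    9 * a ^ 2 * u ^ 8 * h2.1

lemma exists_expansion_sq {u h a b c e : A}
    (hh : h = u ^ 2 + 3 * a * u ^ 4 + b * u ^ 5 + 6 * a ^ 2 * u ^ 6 + 9 * a * b * u ^ 7 +
      c * u ^ 8 + u ^ 9 * e) :
    ∃ e', h ^ 2 = u ^ 4 + 6 * a * u ^ 6 + 2 * b * u ^ 7 + 21 * a ^ 2 * u ^ 8 +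
      24 * a * b * u ^ 9 + u ^ 10 * e' := by
  obtain ⟨m, hm⟩ : ∃ m, m = 6 * a ^ 2 + 9 * a * b * u + c * u ^ 2 + u ^ 3 * e := ⟨_, rfl⟩
  have hh' : h = u ^ 2 + u ^ 4 * (3 * a + b * u + u ^ 2 * m) := by rw [hm, hh]; ring
  refine ⟨2 * c + 2 * u * e + b ^ 2 + 6 * a * (9 * a * b + c * u + u ^ 2 * e) * u + 36 * a ^ 3 +
    2 * b * u * m + u ^ 2 * m ^ 2, ?_⟩
  rw [hh']
  linear_combination (2 * u ^ 8 + 6 * a * u ^ 10) * hm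

lemma exists_expansion_cube {u h a b c e : A}
    (hh : h = u ^ 2 + 3 * a * u ^ 4 + b * u ^ 5 + 6 * a ^ 2 * u ^ 6 + 9 * a * b * u ^ 7 +
      c * u ^ 8 + u ^ 9 * e) :
    ∃ e', h ^ 3 = u ^ 6 + 9 * a * u ^ 8 + 3 * b * u ^ 9 + u ^ 10 * e' := by
  obtain ⟨m, hm⟩ : ∃ m, m = 6 * a ^ 2 + 9 * a * b * u + c * u ^ 2 + u ^ 3 * e := ⟨_, rfl⟩
  have hh' : h = u ^ 2 + u ^ 4 * (3 * a + b * u + u ^ 2 * m) := by rw [hm, hh]; ring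
  refine ⟨3 * m + 3 * (3 * a + b * u + u ^ 2 * m) ^ 2 +
    u ^ 2 * (3 * a + b * u + u ^ 2 * m) ^ 3, ?_⟩
  rw [hh']
  ring

end Expansion

/-! ### Contact of lines, conics and cubics with the normal cubic. -/

section Orders

variable {A : Type*} [CommRing A] [IsDomain A] [IsLocalRing A] [Algebra ℂ A] {u h : A} {a b : ℂ}

lemma pow_dvd_iff_of_eq_sum (hm : IsLocalRing.maximalIdeal A = Ideal.span {u}) (hu : u ≠ 0)
    {n N : ℕ} (hn : n ≤ N) {c : Fin N → ℂ} {x e : A}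
    (hx : x = ∑ k, algebraMap ℂ A (c k) * u ^ (k : ℕ) + u ^ N * e) :
    u ^ n ∣ x ↔ ∀ k : Fin N, (k : ℕ) < n → c k = 0 := by
  rw [hx, dvd_add_left (dvd_mul_of_dvd_left (pow_dvd_pow u hn) e)]
  have h1 : ∑ k, algebraMap ℂ A (c k) * u ^ (k : ℕ) =
      Polynomial.aeval u (∑ k, Polynomial.C (c k) * Polynomial.X ^ (k : ℕ)) := by
    simp
  have h2 : ∀ k : Fin N, (∑ i, Polynomial.C (c i) * Polynomial.X ^ (i : ℕ)).coeff k = c k := by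
    intro k
    simp only [Polynomial.finsetSum_coeff, Polynomial.coeff_C_mul_X_pow, Fin.val_inj]
    simp
  rw [h1, pow_dvd_aeval_iff hm hu, Polynomial.X_pow_dvd_iff]
  exact ⟨fun h k hk => h2 k ▸ h k hk, fun h k hk => (h2 ⟨k, hk.trans_le hn⟩).trans (h _ hk)⟩

/-- `u` and `h` are affine coordinates of the generic point of the normal cubic in a local ring
in which `u` is a uniformizer. -/
structure IsNormalPair (u h : A) (a b : ℂ) : Prop where
  maximalIdeal_eq : IsLocalRing.maximalIdeal A = Ideal.span {u}
  ne_zero : u ≠ 0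
  mem_maximalIdeal : h ∈ IsLocalRing.maximalIdeal A
  relation : h = u ^ 2 + 3 * algebraMap ℂ A a * u ^ 2 * h + algebraMap ℂ A b * u * h ^ 2 -
    3 * algebraMap ℂ A a ^ 2 * h ^ 3

namespace IsNormalPair

/-- The functions 1, u, h have orders 0, 1, 2. -/
lemma line_eq_zero (H : IsNormalPair u h a b) {c : Fin 3 → ℂ}
    (hc : u ^ 3 ∣ aeval ![u, h, 1] (C (c 0) * X 2 + C (c 1) * X 0 + C (c 2) * X 1 :
      MvPolynomial (Fin 3) ℂ)) : c = 0 := by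
  obtain ⟨e, he⟩ := exists_expansion H.ne_zero
    (H.maximalIdeal_eq ▸ Ideal.mem_span_singleton_self u) H.relation H.mem_maximalIdeal
  refine funext fun k => (pow_dvd_iff_of_eq_sum H.maximalIdeal_eq H.ne_zero le_rfl (c := c)
    (e := algebraMap ℂ A (c 2) * (3 * algebraMap ℂ A a * u + algebraMap ℂ A b * u ^ 2 +
      6 * algebraMap ℂ A a ^ 2 * u ^ 3 + 9 * algebraMap ℂ A a * algebraMap ℂ A b * u ^ 4 +
      (2 * algebraMap ℂ A b ^ 2 - 9 * algebraMap ℂ A a ^ 3) * u ^ 5 + u ^ 6 * e)) ?_).1 hc k k.2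
  simp only [map_add, map_mul, algHom_C, aeval_X, Matrix.cons_val, Fin.sum_univ_three, Fin.val_zero,
    Fin.val_one, Fin.val_two]
  linear_combination algebraMap ℂ A (c 2) * he

/-- The functions 1, u, h, uh, h² have orders 0 to 4, and h - u² - 3ah² starts with bu⁵. For b = 0
the latter is a conic with contact at least 6. -/
lemma conic_eq_zero (H : IsNormalPair u h a b) (hb : b ≠ 0) {c : Fin 6 → ℂ}
    (hc : u ^ 6 ∣ aeval ![u, h, 1] (C (c 0) * X 2 ^ 2 + C (c 1) * X 0 * X 2 + C (c 2) * X 1 * X 2 +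
      C (c 3) * X 0 ^ 2 + C (c 4) * X 0 * X 1 + C (c 5) * X 1 ^ 2 : MvPolynomial (Fin 3) ℂ)) :
    c = 0 := by
  obtain ⟨e, he⟩ := exists_expansion H.ne_zero
    (H.maximalIdeal_eq ▸ Ideal.mem_span_singleton_self u) H.relation H.mem_maximalIdeal
  obtain ⟨e', he'⟩ := exists_expansion_sq he
  have h1 := (pow_dvd_iff_of_eq_sum H.maximalIdeal_eq H.ne_zero le_rfl
    (c := ![c 0, c 1, c 2 + c 3, c 4, 3 * a * c 2 + c 5, b * c 2 + 3 * a * c 4])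
    (e := algebraMap ℂ A (c 2) * (6 * algebraMap ℂ A a ^ 2 +
      9 * algebraMap ℂ A a * algebraMap ℂ A b * u +
      (2 * algebraMap ℂ A b ^ 2 - 9 * algebraMap ℂ A a ^ 3) * u ^ 2 + u ^ 3 * e) +
      algebraMap ℂ A (c 4) * (algebraMap ℂ A b + 6 * algebraMap ℂ A a ^ 2 * u +
      9 * algebraMap ℂ A a * algebraMap ℂ A b * u ^ 2 +
      (2 * algebraMap ℂ A b ^ 2 - 9 * algebraMap ℂ A a ^ 3) * u ^ 3 + u ^ 4 * e) +
      algebraMap ℂ A (c 5) * (6 * algebraMap ℂ A a + 2 * algebraMap ℂ A b * u +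
      21 * algebraMap ℂ A a ^ 2 * u ^ 2 + 24 * algebraMap ℂ A a * algebraMap ℂ A b * u ^ 3 +
      u ^ 4 * e')) ?_).1 hc
  · have h2 := fun k => h1 k k.2
    simp only [Fin.forall_fin_succ, Matrix.cons_val_zero, Matrix.cons_val_succ] at h2
    obtain ⟨h20, h21, h22, h23, h24, h25, -⟩ := h2
    have h6 : c 2 = 0 := by
      rw [h23, mul_zero, add_zero] at h25
      exact (mul_eq_zero.1 h25).resolve_left hb
    have h7 : c 5 = 0 := by rwa [h6, mul_zero, zero_add] at h24
    have h8 : c 3 = 0 := by rwa [h6, zero_add] at h22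
    ext k
    fin_cases k <;> assumption
  · simp only [map_add, map_mul, map_pow, algHom_C, aeval_X, Matrix.cons_val, Fin.sum_univ_succ,
      Fin.val_zero, Fin.val_succ, Matrix.cons_val_zero, Matrix.cons_val_succ, Finset.univ_eq_empty,
      Finset.sum_empty, map_ofNat]
    linear_combination (algebraMap ℂ A (c 2) + u * algebraMap ℂ A (c 4)) * he +
      algebraMap ℂ A (c 5) * he'

/-- The vector lists the coefficients of u⁰, ..., u⁹. Removing the term hz² by `c 2 = 0` is a
normalization modulo the cubic itself; it also makes an expansion of h up to u⁹ precise enough,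
since h then occurs only multiplied by u or u². -/
lemma pow_dvd_cubic_iff (H : IsNormalPair u h a b) {n : ℕ} (hn : n ≤ 10) (c : Fin 10 → ℂ)
    (hc : c 2 = 0) :
    u ^ n ∣ aeval ![u, h, 1] (C (c 0) * X 2 ^ 3 + C (c 1) * X 0 * X 2 ^ 2 +
      C (c 2) * X 1 * X 2 ^ 2 +
      C (c 3) * X 0 ^ 2 * X 2 + C (c 4) * X 0 * X 1 * X 2 + C (c 5) * X 1 ^ 2 * X 2 +
      C (c 6) * X 0 ^ 3 + C (c 7) * X 0 ^ 2 * X 1 + C (c 8) * X 0 * X 1 ^ 2 +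
      C (c 9) * X 1 ^ 3 : MvPolynomial (Fin 3) ℂ) ↔
    ∀ k : Fin 10, (k : ℕ) < n → (![c 0, c 1, c 3, c 4 + c 6, c 7 + c 5, 3 * a * c 4 + c 8,
      b * c 4 + 3 * a * c 7 + 6 * a * c 5 + c 9, 6 * a ^ 2 * c 4 + b * c 7 + 2 * b * c 5 +
      6 * a * c 8, 9 * a * b * c 4 + 6 * a ^ 2 * c 7 + 21 * a ^ 2 * c 5 + 2 * b * c 8 + 9 * a * c 9,
      (2 * b ^ 2 - 9 * a ^ 3) * c 4 + 9 * a * b * c 7 + 24 * a * b * c 5 + 21 * a ^ 2 * c 8 +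
      3 * b * c 9] : Fin 10 → ℂ) k = 0 := by
  obtain ⟨e, he⟩ := exists_expansion H.ne_zero
    (H.maximalIdeal_eq ▸ Ideal.mem_span_singleton_self u) H.relation H.mem_maximalIdeal
  obtain ⟨e', he'⟩ := exists_expansion_sq he
  obtain ⟨e'', he''⟩ := exists_expansion_cube he
  refine pow_dvd_iff_of_eq_sum H.maximalIdeal_eq H.ne_zero hn
    (e := algebraMap ℂ A (c 4) * e + algebraMap ℂ A (c 5) * e' +
      algebraMap ℂ A (c 7) * (2 * algebraMap ℂ A b ^ 2 - 9 * algebraMap ℂ A a ^ 3 + u * e) +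
      algebraMap ℂ A (c 8) * (24 * algebraMap ℂ A a * algebraMap ℂ A b + u * e') +
      algebraMap ℂ A (c 9) * e'') ?_
  simp only [map_add, map_sub, map_mul, map_pow, algHom_C, aeval_X, Matrix.cons_val,
    Fin.sum_univ_succ, Fin.val_zero, Fin.val_succ, Matrix.cons_val_zero, Matrix.cons_val_succ,
    Finset.univ_eq_empty, Finset.sum_empty, map_ofNat, hc, map_zero]
  linear_combination (algebraMap ℂ A (c 4) * u + algebraMap ℂ A (c 7) * u ^ 2) * he +
    (algebraMap ℂ A (c 5) + algebraMap ℂ A (c 8) * u) * he' + algebraMap ℂ A (c 9) * he''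

end IsNormalPair

end Orders

/-! ### Local parameters at a point with nonzero coordinates. -/

section LocalParameters

lemma aeval_mul_of_isHomogeneous {σ R A : Type*} [CommRing R] [CommRing A] [Algebra R A]
    {g : MvPolynomial σ R} {d : ℕ} (hg : g.IsHomogeneous d) (s : A) (w : σ → A) :
    aeval (fun i => s * w i) g = s ^ d * aeval w g := by
  rw [aeval_def, eval₂_eq, aeval_def, eval₂_eq, Finset.mul_sum]
  refine Finset.sum_congr rfl fun m hm => ?_
  have hd : ∑ i ∈ m.support, m i = d := by
    have := hg (mem_support_iff.1 hm)
    rwa [Finsupp.weight_apply, Finsupp.sum, Finset.sum_congr rfl (fun i _ => by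
      simp only [Pi.one_apply, smul_eq_mul, mul_one]; rfl)] at this
  simp only [mul_pow, Finset.prod_mul_distrib, Finset.prod_pow_eq_pow_sum, hd]
  ring

/-- The parameter `p³ / q³` of a point `(p : q : r)` of the Fermat cubic. -/
def cubeRatio (P : Plane) : ℂ := P.rep 0 ^ 3 / P.rep 1 ^ 3

/-- The first parameter of the normal form of the Fermat cubic at a point. -/
def paramA (t : ℂ) : ℂ := -(t ^ 2 + t + 1) / 18

/-- The second parameter of the normal form of the Fermat cubic at a point. -/
def paramB (t : ℂ) : ℂ := (1 - t) * (2 * t + 1) * (t + 2) / 27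

/-- The change of coordinates from the coordinates adapted to `P` to the standard ones. -/
def fromAdapted (P : Plane) : MvPolynomial (Fin 3) ℂ →ₐ[ℂ] MvPolynomial (Fin 3) ℂ :=
  aeval (newCoordinates (P.rep 0) (P.rep 1) (P.rep 2) (cubeRatio P))

/-- The change of coordinates from the standard coordinates to those adapted to `P`. -/
def toAdapted (P : Plane) : MvPolynomial (Fin 3) ℂ →ₐ[ℂ] MvPolynomial (Fin 3) ℂ :=
  aeval (oldCoordinates (P.rep 0) (P.rep 1) (P.rep 2) (cubeRatio P))

variable {P : Plane}

lemma isHomogeneous_fromAdapted {g : MvPolynomial (Fin 3) ℂ} {d : ℕ} (hg : g.IsHomogeneous d) :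
    (fromAdapted P g).IsHomogeneous d :=
  isHomogeneous_aeval hg isHomogeneous_newCoordinates

lemma isHomogeneous_toAdapted {g : MvPolynomial (Fin 3) ℂ} {d : ℕ} (hg : g.IsHomogeneous d) :
    (toAdapted P g).IsHomogeneous d :=
  isHomogeneous_aeval hg isHomogeneous_oldCoordinates

lemma isHomogeneous_normalCubic (a b : ℂ) : (normalCubic a b).IsHomogeneous 3 := by
  have h0 := fun i => isHomogeneous_X ℂ (i : Fin 3)
  have h1 := fun i n => isHomogeneous_X_pow (R := ℂ) (i : Fin 3) n
  exact ((((h0 1).mul (h1 2 2)).sub ((h1 0 2).mul (h0 2))).sub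
    ((isHomogeneous_C_mul (h1 0 2)).mul (h0 1))).sub
    ((isHomogeneous_C_mul (h0 0)).mul (h1 1 2)) |>.add (isHomogeneous_C_mul (h1 1 3))

/-- `P` is a point of the Fermat cubic none of whose coordinates is zero. -/
structure IsGeneral (P : Plane) : Prop where
  mem : fermatCubic ℂ ∈ pointIdeal ℂ P
  rep_ne_zero : ∀ i, P.rep i ≠ 0

namespace IsGeneral

variable (hP : IsGeneral P)
include hP

lemma cube_zero : P.rep 0 ^ 3 = cubeRatio P * P.rep 1 ^ 3 :=
  (div_mul_cancel₀ _ (pow_ne_zero 3 (hP.rep_ne_zero 1))).symm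

lemma cube_two : P.rep 2 ^ 3 = -(1 + cubeRatio P) * P.rep 1 ^ 3 := by
  have h1 := hP.cube_zero
  have h2 := (fermatCubic_mem_pointIdeal ℂ P).1 hP.mem
  linear_combination h2 - h1

lemma cubeRatio_ne_zero : cubeRatio P ≠ 0 :=
  div_ne_zero (pow_ne_zero 3 (hP.rep_ne_zero 0)) (pow_ne_zero 3 (hP.rep_ne_zero 1))

lemma one_add_cubeRatio_ne_zero : 1 + cubeRatio P ≠ 0 := by
  intro h
  have := hP.cube_two
  rw [h, neg_zero, zero_mul] at this
  exact hP.rep_ne_zero 2 (pow_eq_zero_iff (by norm_num) |>.1 this)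

lemma cubeRatio_mul_ne_zero : cubeRatio P * (1 + cubeRatio P) ≠ 0 :=
  mul_ne_zero hP.cubeRatio_ne_zero hP.one_add_cubeRatio_ne_zero

lemma fromAdapted_toAdapted (g : MvPolynomial (Fin 3) ℂ) : fromAdapted P (toAdapted P g) = g :=
  aeval_newCoordinates_oldCoordinates (hP.rep_ne_zero 0) (hP.rep_ne_zero 1) (hP.rep_ne_zero 2)
    hP.cubeRatio_mul_ne_zero g

lemma fermatCubic_eq : ∃ c : ℂ, c ≠ 0 ∧ fermatCubic ℂ = C c *
    fromAdapted P (normalCubic (paramA (cubeRatio P)) (paramB (cubeRatio P))) := by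
  refine ⟨-3 * P.rep 1 ^ 3 * (cubeRatio P * (1 + cubeRatio P)), mul_ne_zero (mul_ne_zero
    (by norm_num) (pow_ne_zero 3 (hP.rep_ne_zero 1))) hP.cubeRatio_mul_ne_zero, ?_⟩
  conv_lhs => rw [← hP.fromAdapted_toAdapted (fermatCubic ℂ), toAdapted,
    aeval_oldCoordinates_fermatCubic hP.cube_zero hP.cube_two]
  rw [map_mul, algHom_C]
  rfl

lemma isDomain : IsDomain (CurveLocalRing (fermatCubic ℂ) P) :=
  isDomain_curveLocalRing prime_fermatCubic hP.mem

lemma isLocalRing : IsLocalRing (CurveLocalRing (fermatCubic ℂ) P) :=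
  isLocalRing_curveLocalRing prime_fermatCubic hP.mem

lemma isUnit_restrict_fromAdapted_X_two :
    IsUnit (restrict (fermatCubic ℂ) P (fromAdapted P (X 2))) := by
  refine isUnit_restrict ?_
  rw [mem_pointIdeal_of_isHomogeneous (isHomogeneous_fromAdapted (isHomogeneous_X _ _))]
  have h0 := hP.rep_ne_zero 0
  have h1 := hP.rep_ne_zero 1
  have h2 := hP.rep_ne_zero 2
  simp [fromAdapted, newCoordinates, h0, h1, h2]

lemma fromAdapted_X_zero_ne_zero : fromAdapted P (X 0) ≠ 0 := by
  intro h
  -- Here U = 1 and V = -t, so the tangent form vanishes and the first adapted coordinate is 1.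
  have := congrArg (eval ![P.rep 0, - cubeRatio P * P.rep 1, 0]) h
  have h0 := hP.rep_ne_zero 0
  have h1 := hP.rep_ne_zero 1
  simp only [fromAdapted, newCoordinates, aeval_X, Matrix.cons_val, map_add, map_sub, map_mul,
    eval_C, eval_X, map_zero] at this
  field_simp at this
  simp at this

/-- The third adapted coordinate is a unit at `P`; dividing by it dehomogenizes every form up to a
unit. The maximal ideal is generated by combinations of the other two coordinates, and the expansion
shows that h is a multiple of u. -/
lemma exists_isNormalPair [IsLocalRing (CurveLocalRing (fermatCubic ℂ) P)]
    [IsDomain (CurveLocalRing (fermatCubic ℂ) P)] :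
    ∃ u h : CurveLocalRing (fermatCubic ℂ) P,
    IsNormalPair u h (paramA (cubeRatio P)) (paramB (cubeRatio P)) ∧
    ∀ (d : ℕ) (g : MvPolynomial (Fin 3) ℂ), g.IsHomogeneous d →
      Associated (restrict (fermatCubic ℂ) P (fromAdapted P g)) (aeval ![u, h, 1] g) := by
  obtain ⟨z, hz⟩ := hP.isUnit_restrict_fromAdapted_X_two
  set ρ := restrict (fermatCubic ℂ) P with hρ
  set u := ↑z⁻¹ * ρ (fromAdapted P (X 0)) with hu
  set h := ↑z⁻¹ * ρ (fromAdapted P (X 1)) with hh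
  have hz' : (z : CurveLocalRing (fermatCubic ℂ) P) * ↑z⁻¹ = 1 := z.mul_inv
  have key : ∀ (d : ℕ) (g : MvPolynomial (Fin 3) ℂ), g.IsHomogeneous d →
      ρ (fromAdapted P g) = ↑z ^ d * aeval ![u, h, 1] g := by
    intro d g hg
    rw [← aeval_mul_of_isHomogeneous hg]
    have : ρ.comp (fromAdapted P) = aeval (fun i => ↑z * ![u, h, 1] i) := by
      apply MvPolynomial.algHom_ext
      intro i
      rw [AlgHom.comp_apply, aeval_X]
      fin_cases i
      · change ρ (fromAdapted P (X 0)) = ↑z * u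
        rw [hu, ← mul_assoc, hz', one_mul]
      · change ρ (fromAdapted P (X 1)) = ↑z * h
        rw [hh, ← mul_assoc, hz', one_mul]
      · change ρ (fromAdapted P (X 2)) = ↑z * 1
        rw [← hz, mul_one]
    rw [← this, AlgHom.comp_apply]
  have hrel : h = u ^ 2 + 3 * algebraMap ℂ _ (paramA (cubeRatio P)) * u ^ 2 * h +
      algebraMap ℂ _ (paramB (cubeRatio P)) * u * h ^ 2 -
      3 * algebraMap ℂ _ (paramA (cubeRatio P)) ^ 2 * h ^ 3 := by
    obtain ⟨c, hc, hF⟩ := hP.fermatCubic_eq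
    have h1 : ρ (fermatCubic ℂ) = 0 := restrict_self
    have h1 := (congrArg ρ hF).symm.trans h1
    rw [map_mul, algHom_C, key 3 _ (isHomogeneous_normalCubic _ _)] at h1
    have hc' : IsUnit (algebraMap ℂ (CurveLocalRing (fermatCubic ℂ) P) c) :=
      (isUnit_iff_ne_zero.2 hc).map _
    rw [hc'.mul_right_eq_zero, (z.isUnit.pow 3).mul_right_eq_zero] at h1
    simp only [normalCubic, map_add, map_sub, map_mul, map_pow, aeval_X, algHom_C,
      Matrix.cons_val, map_ofNat] at h1
    linear_combination h1
  have hgen := maximalIdeal_curveLocalRing_eq_span (f := fermatCubic ℂ) (hP.rep_ne_zero 2)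
  have h0 := hP.rep_ne_zero 0
  have h1 := hP.rep_ne_zero 1
  have h2 := hP.rep_ne_zero 2
  have ht := hP.cubeRatio_mul_ne_zero
  have hmem : ∀ i, ρ (X i - C (P.rep i / P.rep 2) * X 2) ∈
      IsLocalRing.maximalIdeal (CurveLocalRing (fermatCubic ℂ) P) := fun i =>
    hgen ▸ Ideal.subset_span ⟨i, rfl⟩
  have hC : ∀ (c : ℂ) (g : MvPolynomial (Fin 3) ℂ) (I : Ideal (CurveLocalRing (fermatCubic ℂ) P)),
      ρ g ∈ I → ρ (C c * g) ∈ I := fun c g I hg => by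
    rw [map_mul]
    exact Ideal.mul_mem_left _ _ hg
  have hU : ρ (C (P.rep 0)⁻¹ * X 0 - C (P.rep 2)⁻¹ * X 2) ∈
      IsLocalRing.maximalIdeal (CurveLocalRing (fermatCubic ℂ) P) := by
    convert hC (P.rep 0)⁻¹ _ _ (hmem 0) using 2
    rw [mul_sub, ← mul_assoc, ← C_mul]
    congr 4
    field_simp
  have hV : ρ (C (P.rep 1)⁻¹ * X 1 - C (P.rep 2)⁻¹ * X 2) ∈
      IsLocalRing.maximalIdeal (CurveLocalRing (fermatCubic ℂ) P) := by
    convert hC (P.rep 1)⁻¹ _ _ (hmem 1) using 2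
    rw [mul_sub, ← mul_assoc, ← C_mul]
    congr 4
    field_simp
  have hH : ρ (fromAdapted P (X 1)) ∈
      IsLocalRing.maximalIdeal (CurveLocalRing (fermatCubic ℂ) P) := by
    rw [fromAdapted, aeval_X]
    refine hC _ _ _ ?_
    rw [map_add]
    exact Ideal.add_mem _ hV (hC _ _ _ hU)
  have hU' : ρ (fromAdapted P (X 0)) ∈
      IsLocalRing.maximalIdeal (CurveLocalRing (fermatCubic ℂ) P) := by
    rw [fromAdapted, aeval_X] at hH ⊢
    refine (map_add ρ _ _).symm ▸ Ideal.add_mem _ hU (hC _ _ _ hH)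
  have hum : u ∈ IsLocalRing.maximalIdeal (CurveLocalRing (fermatCubic ℂ) P) :=
    Ideal.mul_mem_left _ _ hU'
  have hhm : h ∈ IsLocalRing.maximalIdeal (CurveLocalRing (fermatCubic ℂ) P) :=
    Ideal.mul_mem_left _ _ hH
  have hu0 : u ≠ 0 := by
    rw [hu, Ne, (z⁻¹).isUnit.mul_right_eq_zero, hρ, restrict_eq_zero_iff prime_fermatCubic hP.mem]
    intro hdvd
    have h3 := totalDegree_le_of_dvd_of_isDomain hdvd hP.fromAdapted_X_zero_ne_zero
    rw [(isHomogeneous_fermatCubic ℂ).totalDegree prime_fermatCubic.ne_zero,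
      (isHomogeneous_fromAdapted (isHomogeneous_X ℂ 0)).totalDegree
        hP.fromAdapted_X_zero_ne_zero] at h3
    omega
  obtain ⟨e, he⟩ := exists_expansion hu0 hum hrel hhm
  have hus : u ∈ Ideal.span {u} := Ideal.mem_span_singleton_self u
  have hhs : h ∈ Ideal.span {u} := by
    rw [Ideal.mem_span_singleton, he]
    have hpow : ∀ n (x : CurveLocalRing (fermatCubic ℂ) P), u ∣ x * u ^ (n + 1) := fun n x =>
      dvd_mul_of_dvd_right (dvd_pow_self u n.succ_ne_zero) x
    exact dvd_add (dvd_add (dvd_add (dvd_add (dvd_add (dvd_add (dvd_pow_self u two_ne_zero)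
      (hpow _ _)) (hpow _ _)) (hpow _ _)) (hpow _ _)) (hpow _ _)) (mul_comm _ e ▸ hpow 8 e)
  have hzu : ρ (fromAdapted P (X 0)) ∈ Ideal.span {u} := by
    rw [key 1 _ (isHomogeneous_X _ _), aeval_X]
    exact Ideal.mul_mem_left _ _ hus
  have hzh : ρ (fromAdapted P (X 1)) ∈ Ideal.span {u} := by
    rw [key 1 _ (isHomogeneous_X _ _), aeval_X]
    exact Ideal.mul_mem_left _ _ hhs
  have hUs : ρ (X 0 - C (P.rep 0 / P.rep 2) * X 2) ∈ Ideal.span {u} := by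
    have h3 : (X 0 - C (P.rep 0 / P.rep 2) * X 2 : MvPolynomial (Fin 3) ℂ) = C (P.rep 0) *
        (fromAdapted P (X 0) + C (-(2 * cubeRatio P + 1) / 3) * fromAdapted P (X 1)) := by
      apply MvPolynomial.funext
      intro x
      simp only [fromAdapted, newCoordinates, aeval_X, Matrix.cons_val, map_add, map_sub, map_mul,
        eval_C, eval_X]
      field_simp
      ring
    rw [h3]
    exact hC _ _ _ ((map_add ρ _ _).symm ▸ Ideal.add_mem _ hzu (hC _ _ _ hzh))
  have hVs : ρ (X 1 - C (P.rep 1 / P.rep 2) * X 2) ∈ Ideal.span {u} := by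
    have h3 : (X 1 - C (P.rep 1 / P.rep 2) * X 2 : MvPolynomial (Fin 3) ℂ) = C (P.rep 1) *
        (C (-cubeRatio P) * fromAdapted P (X 0) + C (cubeRatio P * (2 * cubeRatio P + 1) / 3 -
          cubeRatio P * (1 + cubeRatio P)) * fromAdapted P (X 1)) := by
      have ht0 := hP.cubeRatio_ne_zero
      have ht1 := hP.one_add_cubeRatio_ne_zero
      apply MvPolynomial.funext
      intro x
      simp only [fromAdapted, newCoordinates, aeval_X, Matrix.cons_val, map_add, map_sub, map_mul,
        eval_C, eval_X]
      field_simp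
      ring
    rw [h3]
    exact hC _ _ _ ((map_add ρ _ _).symm ▸ Ideal.add_mem _ (hC _ _ _ hzu) (hC _ _ _ hzh))
  refine ⟨u, h, ⟨?_, ?_, ?_, hrel⟩, fun d g hg => ?_⟩
  · apply le_antisymm _ ((Ideal.span_singleton_le_iff_mem _).2 hum)
    rw [hgen, Ideal.span_le]
    rintro _ ⟨i, rfl⟩
    fin_cases i
    · exact hUs
    · exact hVs
    · simp [div_self h2]
  · exact hu0
  · exact hhm
  · rw [key d g hg, mul_comm]
    exact (associated_mul_unit_left _ _ (z.isUnit.pow d))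

end IsGeneral

end LocalParameters

/-! ### Classification of the type 9 points. -/

section Classification

lemma homogeneousComponent_mul_totalDegree {σ R : Type*} [CommRing R] (x y : MvPolynomial σ R) :
    homogeneousComponent (x.totalDegree + y.totalDegree) (x * y) =
      homogeneousComponent x.totalDegree x * homogeneousComponent y.totalDegree y := by
  have hxy : x * y = ∑ i ∈ Finset.range (x.totalDegree + 1), ∑ j ∈ Finset.range (y.totalDegree + 1),
      homogeneousComponent i x * homogeneousComponent j y := by
    rw [← Finset.sum_mul_sum, sum_homogeneousComponent, sum_homogeneousComponent]
  rw [hxy]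
  simp only [map_sum]
  have h : ∀ i j, homogeneousComponent (x.totalDegree + y.totalDegree)
      (homogeneousComponent i x * homogeneousComponent j y) =
      if x.totalDegree + y.totalDegree = i + j then
        homogeneousComponent i x * homogeneousComponent j y else 0 := fun i j =>
    homogeneousComponent_of_mem ((homogeneousComponent_isHomogeneous i x).mul
      (homogeneousComponent_isHomogeneous j y))
  simp only [h]
  rw [Finset.sum_eq_single x.totalDegree, Finset.sum_eq_single y.totalDegree, if_pos rfl]
  · intro j hj hj'
    rw [if_neg (by omega)]
  · intro hj
    simp at hj
  · intro i hi hi'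
    refine Finset.sum_eq_zero fun j hj => ?_
    rw [Finset.mem_range] at hi hj
    rw [if_neg (by omega)]
  · intro hj
    simp at hj

/-- The top-degree components of the factors of a form again give a factorization, so only a line
times a conic has to be excluded. -/
lemma irreducible_of_isHomogeneous_three {g : MvPolynomial (Fin 3) ℂ} (hg : g.IsHomogeneous 3)
    (h0 : g ≠ 0) (h : ∀ l q : MvPolynomial (Fin 3) ℂ, l.IsHomogeneous 1 → q.IsHomogeneous 2 →
      g ≠ l * q) : Irreducible g := by
  have hdeg := hg.totalDegree h0
  refine ⟨fun hu => ?_, fun x y hxy => ?_⟩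
  · rw [(MvPolynomial.isUnit_iff_totalDegree_of_isReduced.mp hu).2] at hdeg
    omega
  · have hx0 : x ≠ 0 := by rintro rfl; exact h0 (by rw [hxy, zero_mul])
    have hy0 : y ≠ 0 := by rintro rfl; exact h0 (by rw [hxy, mul_zero])
    have hd : x.totalDegree + y.totalDegree = 3 := by
      rw [← totalDegree_mul_of_isDomain hx0 hy0, ← hxy, hdeg]
    have hc := homogeneousComponent_mul_totalDegree x y
    rw [hd, ← hxy, homogeneousComponent_eq_self hg] at hc
    have hunit : ∀ z : MvPolynomial (Fin 3) ℂ, z ≠ 0 → z.totalDegree = 0 → IsUnit z := by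
      intro z hz hz'
      rw [totalDegree_eq_zero_iff_eq_C] at hz'
      rw [hz'] at hz ⊢
      exact (isUnit_iff_ne_zero.2 fun h => hz (by rw [h, C_0])).map C
    have hcase : x.totalDegree = 0 ∨ x.totalDegree = 1 ∨ x.totalDegree = 2 ∨ x.totalDegree = 3 := by
      omega
    rcases hcase with hx | hx | hx | hx
    · exact Or.inl (hunit x hx0 hx)
    · have hy : y.totalDegree = 2 := by omega
      rw [hx, hy] at hc
      exact absurd hc (h _ _ (homogeneousComponent_isHomogeneous 1 x)
        (homogeneousComponent_isHomogeneous 2 y))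
    · have hy : y.totalDegree = 1 := by omega
      rw [hx, hy, mul_comm] at hc
      exact absurd hc (h _ _ (homogeneousComponent_isHomogeneous 1 y)
        (homogeneousComponent_isHomogeneous 2 x))
    · exact Or.inr (hunit y hy0 (by omega))

variable {P : Plane}

/-- This forces b ≠ 0 wherever a = 0 and t(1 + t) ≠ 0. -/
lemma paramB_sq (t : ℂ) :
    paramB t ^ 2 = -32 * paramA t ^ 3 - (t * (1 + t)) ^ 2 / 27 := by
  unfold paramA paramB
  ring

/-- The cubic form with coefficients `c`. -/
def cubicForm (c : Fin 10 → ℂ) : MvPolynomial (Fin 3) ℂ :=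
  C (c 0) * X 2 ^ 3 + C (c 1) * X 0 * X 2 ^ 2 + C (c 2) * X 1 * X 2 ^ 2 +
      C (c 3) * X 0 ^ 2 * X 2 + C (c 4) * X 0 * X 1 * X 2 + C (c 5) * X 1 ^ 2 * X 2 +
      C (c 6) * X 0 ^ 3 + C (c 7) * X 0 ^ 2 * X 1 + C (c 8) * X 0 * X 1 ^ 2 +
      C (c 9) * X 1 ^ 3

lemma IsGeneral.le_intersectionMultiplicity_iff (hP : IsGeneral P) :
    ∃ (A : Type) (_ : CommRing A) (_ : IsLocalRing A) (_ : IsDomain A) (_ : Algebra ℂ A) (u h : A),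
      IsNormalPair u h (paramA (cubeRatio P)) (paramB (cubeRatio P)) ∧
      ∀ (d : ℕ) (g : MvPolynomial (Fin 3) ℂ) (n : ℕ), g.IsHomogeneous d →
        ((n : ℕ∞) ≤ intersectionMultiplicity (fermatCubic ℂ) (fromAdapted P g) P ↔
          u ^ n ∣ aeval ![u, h, 1] g) := by
  have := hP.isDomain
  have := hP.isLocalRing
  obtain ⟨u, h, H, hass⟩ := hP.exists_isNormalPair
  refine ⟨CurveLocalRing (fermatCubic ℂ) P, inferInstance, inferInstance, inferInstance,
    inferInstance, u, h, H, fun d g n hg => ?_⟩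
  rw [intersectionMultiplicity_eq_ord, le_ord_iff_dvd H.maximalIdeal_eq H.ne_zero]
  exact (hass d g hg).dvd_iff_dvd_right

lemma IsGeneral.not_isFlex (hP : IsGeneral P) : ¬ IsFlex (fermatCubic ℂ) P := by
  rintro ⟨-, l, hl0, hl, hl2⟩
  obtain ⟨A, _, _, _, _, u, h, H, hmul⟩ := hP.le_intersectionMultiplicity_iff
  obtain ⟨c, hc⟩ := exists_eq_line (isHomogeneous_toAdapted (P := P) hl)
  have h1 := (hmul 1 (toAdapted P l) 3 (isHomogeneous_toAdapted hl)).1 (by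
    rw [hP.fromAdapted_toAdapted]
    exact Order.add_one_le_of_lt hl2)
  rw [hc] at h1
  have h2 := H.line_eq_zero h1
  apply hl0
  rw [← hP.fromAdapted_toAdapted l, hc, h2]
  simp

lemma isGeneral_of_isTypeNine (h : IsTypeNine (fermatCubic ℂ) P) : IsGeneral P :=
  ⟨h.1, fun _ hi => h.2.1 (isFlex_of_rep_eq_zero h.1 hi)⟩

lemma IsNormalPair.aeval_normalCubic {A : Type*} [CommRing A] [IsLocalRing A] [IsDomain A]
    [Algebra ℂ A] {u h : A} {a b : ℂ} (H : IsNormalPair u h a b) :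
    aeval ![u, h, 1] (normalCubic a b) = 0 := by
  simp only [normalCubic, map_add, map_sub, map_mul, map_pow, aeval_X, algHom_C,
      Matrix.cons_val, map_ofNat]
  linear_combination H.relation

lemma param_eq_zero_of_isTypeNine (h : IsTypeNine (fermatCubic ℂ) P) :
    paramA (cubeRatio P) * (paramB (cubeRatio P) ^ 2 + 24 * paramA (cubeRatio P) ^ 3) = 0 := by
  have hP := isGeneral_of_isTypeNine h
  obtain ⟨-, -, g, hg, -, hg9⟩ := h
  obtain ⟨A, _, _, _, _, u, h, H, hmul⟩ := hP.le_intersectionMultiplicity_iff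
  obtain ⟨c, hc⟩ := exists_eq_cubic (isHomogeneous_toAdapted (P := P) hg)
  generalize paramA (cubeRatio P) = a at H ⊢
  generalize paramB (cubeRatio P) = b at H ⊢
  by_contra hab
  have ha : a ≠ 0 := left_ne_zero_of_mul hab
  have hab' := right_ne_zero_of_mul hab
  have h9 := (hmul 3 (toAdapted P g) 9 (isHomogeneous_toAdapted hg)).1 (by
    rw [hP.fromAdapted_toAdapted, hg9]; norm_num)
  have h10 := (hmul 3 (toAdapted P g) 10 (isHomogeneous_toAdapted hg)).2.mt (by
    rw [hP.fromAdapted_toAdapted, hg9]; norm_num)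
  -- A multiple of the normal cubic is subtracted to remove the term hz²; local orders do not
  -- change.
  obtain ⟨d, hd⟩ : ∃ d : Fin 10 → ℂ, d = ![c 0, c 1, 0, c 3 + c 2, c 4, c 5, c 6,
    c 7 + 3 * a * c 2, c 8 + b * c 2, c 9 - 3 * a ^ 2 * c 2] := ⟨_, rfl⟩
  have k2' : d 2 = 0 := by rw [hd]; rfl
  have hcd : toAdapted P g = cubicForm d + C (c 2) * normalCubic a b := by
    rw [hc, cubicForm, normalCubic]
    simp only [hd, Matrix.cons_val, map_add, map_sub, map_mul, map_zero]
    ring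
  rw [hcd, map_add, map_mul, H.aeval_normalCubic, mul_zero, add_zero] at h9 h10
  have hd0 : d = 0 := by
    have h1 := fun k => (H.pow_dvd_cubic_iff (by norm_num) d k2').1 h9 k
    simp only [Fin.forall_fin_succ, Matrix.cons_val_zero, Matrix.cons_val_succ, Fin.val_zero,
      Fin.val_succ, Nat.reduceAdd, Nat.reduceLT, forall_const] at h1
    obtain ⟨k0, k1, k2, k3, k4, k5, k6, k7, k8, -⟩ := h1
    -- The nine conditions reduce to two equations in `d 4` and `d 5`, of determinant ±(b² + 24a³)
    -- once a factor a is cancelled. If `d` is zero the contact is infinite, not 9.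
    have e1 : b * d 5 = 12 * a ^ 2 * d 4 := by linear_combination k7 - b * k4 - 6 * a * k5
    have e2 : b * d 4 + 2 * a * d 5 = 0 := by
      apply (mul_eq_zero.1 _).resolve_left ha
      linear_combination (-1 / 6 : ℂ) * k8 + a ^ 2 * k4 + b / 3 * k5 + 3 / 2 * a * k6 -
        9 / 2 * a ^ 2 * k4
    have e3 : d 4 = 0 := by
      apply (mul_eq_zero.1 _).resolve_left hab'
      linear_combination b * e2 - 2 * a * e1
    have e4 : d 5 = 0 := by
      apply (mul_eq_zero.1 _).resolve_left hab'
      linear_combination b * e1 + 12 * a ^ 2 * e2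
    have e5 : d 6 = 0 := by linear_combination k3 - e3
    have e6 : d 7 = 0 := by linear_combination k4 - e4
    have e7 : d 8 = 0 := by linear_combination k5 - 3 * a * e3
    have e8 : d 9 = 0 := by linear_combination k6 - b * e3 - 3 * a * e6 - 6 * a * e4
    ext k
    fin_cases k <;> assumption
  rw [hd0] at h10
  simp [cubicForm] at h10

lemma IsNormalPair.not_pow_dvd_mul {A : Type*} [CommRing A] [IsLocalRing A] [IsDomain A]
    [Algebra ℂ A] {u h : A} {a b : ℂ} (H : IsNormalPair u h a b) {x y : A} {m n : ℕ}
    (hx : ¬ u ^ m ∣ x) (hy : ¬ u ^ n ∣ y) : ¬ u ^ (m + n) ∣ x * y := by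
  have hy0 : y ≠ 0 := by rintro rfl; exact hy (dvd_zero _)
  rw [← le_ord_iff_dvd H.maximalIdeal_eq H.ne_zero] at hx hy ⊢
  rw [Ring.ord_mul A (mem_nonZeroDivisors_of_ne_zero hy0), not_le, Nat.cast_add]
  exact ENat.add_lt_add (not_le.1 hx) (not_le.1 hy)

lemma isHomogeneous_cubicForm (c : Fin 10 → ℂ) : (cubicForm c).IsHomogeneous 3 := by
  have h1 := fun (c : ℂ) i j k => isHomogeneous_C_mul (c := c) (((isHomogeneous_X_pow (R := ℂ)
    (0 : Fin 3) i).mul (isHomogeneous_X_pow 1 j)).mul (isHomogeneous_X_pow 2 k))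
  have h2 : cubicForm c = C (c 0) * (X 0 ^ 0 * X 1 ^ 0 * X 2 ^ 3) +
      C (c 1) * (X 0 ^ 1 * X 1 ^ 0 * X 2 ^ 2) + C (c 2) * (X 0 ^ 0 * X 1 ^ 1 * X 2 ^ 2) +
      C (c 3) * (X 0 ^ 2 * X 1 ^ 0 * X 2 ^ 1) + C (c 4) * (X 0 ^ 1 * X 1 ^ 1 * X 2 ^ 1) +
      C (c 5) * (X 0 ^ 0 * X 1 ^ 2 * X 2 ^ 1) + C (c 6) * (X 0 ^ 3 * X 1 ^ 0 * X 2 ^ 0) +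
      C (c 7) * (X 0 ^ 2 * X 1 ^ 1 * X 2 ^ 0) + C (c 8) * (X 0 ^ 1 * X 1 ^ 2 * X 2 ^ 0) +
      C (c 9) * (X 0 ^ 0 * X 1 ^ 3 * X 2 ^ 0) := by
    rw [cubicForm]
    ring
  rw [h2]
  exact (((((((((h1 _ 0 0 3).add (h1 _ 1 0 2)).add (h1 _ 0 1 2)).add (h1 _ 2 0 1)).add
    (h1 _ 1 1 1)).add (h1 _ 0 2 1)).add (h1 _ 3 0 0)).add (h1 _ 2 1 0)).add (h1 _ 1 2 0)).add
    (h1 _ 0 3 0)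

/-- A line times a conic has contact at most 2 + 5 < 9, so contact 9 already gives irreducibility.
-/
lemma IsGeneral.isTypeNine_of_cubicForm (hP : IsGeneral P) (hb : paramB (cubeRatio P) ≠ 0)
    (c : Fin 10 → ℂ)
    (hc : ∀ (A : Type) [CommRing A] [IsLocalRing A] [IsDomain A] [Algebra ℂ A] (u h : A),
      IsNormalPair u h (paramA (cubeRatio P)) (paramB (cubeRatio P)) →
      u ^ 9 ∣ aeval ![u, h, 1] (cubicForm c) ∧ ¬ u ^ 10 ∣ aeval ![u, h, 1] (cubicForm c)) :
    IsTypeNine (fermatCubic ℂ) P := by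
  obtain ⟨A, _, _, _, _, u, h, H, hmul⟩ := hP.le_intersectionMultiplicity_iff
  obtain ⟨h9, h10⟩ := hc A u h H
  rw [← hmul 3 _ _ (isHomogeneous_cubicForm c)] at h9 h10
  have hg := isHomogeneous_fromAdapted (P := P) (isHomogeneous_cubicForm c)
  set g := fromAdapted P (cubicForm c)
  have hg0 : g ≠ 0 := by
    intro h0
    have := (hmul 3 0 10 (isHomogeneous_zero _ _ _)).2 (by rw [map_zero]; exact dvd_zero _)
    rw [map_zero] at this
    exact h10 (h0 ▸ this)
  refine ⟨hP.mem, hP.not_isFlex, g, hg, irreducible_of_isHomogeneous_three hg hg0 ?_, ?_⟩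
  · intro l q hl hq hlq
    have h9' := (hmul 3 (toAdapted P g) 9 (isHomogeneous_toAdapted hg)).1 (by
      rwa [hP.fromAdapted_toAdapted])
    rw [hlq, map_mul, map_mul] at h9'
    have hinj : ∀ f : MvPolynomial (Fin 3) ℂ, toAdapted P f = 0 → f = 0 := fun f hf => by
      rw [← hP.fromAdapted_toAdapted f, hf, map_zero]
    refine H.not_pow_dvd_mul (m := 3) (n := 6) ?_ ?_ h9'
    · intro h3
      obtain ⟨d, hd⟩ := exists_eq_line (isHomogeneous_toAdapted (P := P) hl)
      rw [hd] at h3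
      have := H.line_eq_zero h3
      rw [this] at hd
      refine hg0 (hlq.trans ?_)
      rw [hinj l (by rw [hd]; simp), zero_mul]
    · intro h3
      obtain ⟨d, hd⟩ := exists_eq_conic (isHomogeneous_toAdapted (P := P) hq)
      rw [hd] at h3
      have := H.conic_eq_zero hb h3
      rw [this] at hd
      refine hg0 (hlq.trans ?_)
      rw [hinj q (by rw [hd]; simp), mul_zero]
  · refine le_antisymm ?_ h9
    rw [not_le] at h10
    exact Order.le_of_lt_add_one (h10.trans_eq (by norm_num))

lemma IsGeneral.isTypeNine (hP : IsGeneral P)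
    (h : paramA (cubeRatio P) * (paramB (cubeRatio P) ^ 2 + 24 * paramA (cubeRatio P) ^ 3) = 0) :
    IsTypeNine (fermatCubic ℂ) P := by
  have hab := paramB_sq (cubeRatio P)
  have ht := hP.cubeRatio_mul_ne_zero
  generalize hA : paramA (cubeRatio P) = a at h hab
  generalize hB : paramB (cubeRatio P) = b at h hab
  by_cases ha : a = 0
  · subst ha
    have hb : b ≠ 0 := by
      rintro rfl
      have : (cubeRatio P * (1 + cubeRatio P)) ^ 2 = 0 := by linear_combination 27 * hab
      exact ht (pow_eq_zero_iff two_ne_zero |>.1 this)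
    -- The cubic uhz - u³ - bh³, whose u⁹ coefficient is -b².
    refine hP.isTypeNine_of_cubicForm (hB ▸ hb) ![0, 0, 0, 0, 1, 0, -1, 0, 0, -b] ?_
    intro A _ _ _ _ u h H
    rw [hA, hB] at H
    rw [cubicForm, H.pow_dvd_cubic_iff (by norm_num) _ rfl, H.pow_dvd_cubic_iff le_rfl _ rfl]
    refine ⟨fun k hk => ?_, fun h1 => ?_⟩
    · fin_cases k <;> simp at hk ⊢
    · have h2 := h1 9 (by decide)
      simp only [Matrix.cons_val] at h2
      exact pow_ne_zero 2 hb (by linear_combination -h2)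
  · have hb2 : b ^ 2 = -24 * a ^ 3 := by
      linear_combination (mul_eq_zero.1 h).resolve_left ha
    have hb : b ≠ 0 := by
      rintro rfl
      exact pow_ne_zero 3 ha (by linear_combination 1 / 24 * hb2)
    -- The pair (2a, -b) solves the two equations for the coefficients of uhz and h²z; the other
    -- coefficients are then determined. The u⁹ coefficient is 48a⁴.
    refine hP.isTypeNine_of_cubicForm (hB ▸ hb)
      ![0, 0, 0, 0, 2 * a, -b, -2 * a, b, -6 * a ^ 2, a * b] ?_
    intro A _ _ _ _ u h H
    rw [hA, hB] at H
    rw [cubicForm, H.pow_dvd_cubic_iff (by norm_num) _ rfl, H.pow_dvd_cubic_iff le_rfl _ rfl]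
    refine ⟨fun k hk => ?_, fun h1 => ?_⟩
    · simp only [Matrix.cons_val]
      fin_cases k
      · rfl
      · rfl
      · rfl
      · simp
      · simp
      · change 3 * a * (2 * a) + -6 * a ^ 2 = 0
        ring
      · change b * (2 * a) + 3 * a * b + 6 * a * -b + a * b = 0
        ring
      · change 6 * a ^ 2 * (2 * a) + b * b + 2 * b * -b + 6 * a * (-6 * a ^ 2) = 0
        linear_combination -hb2
      · change 9 * a * b * (2 * a) + 6 * a ^ 2 * b + 21 * a ^ 2 * -b + 2 * b * (-6 * a ^ 2) +
          9 * a * (a * b) = 0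
        ring
      · exact absurd hk (by decide)
    · have h2 := h1 9 (by decide)
      change (2 * b ^ 2 - 9 * a ^ 3) * (2 * a) + 9 * a * b * b + 24 * a * b * -b +
        21 * a ^ 2 * (-6 * a ^ 2) + 3 * b * (a * b) = 0 at h2
      exact pow_ne_zero 4 ha (by linear_combination 1 / 48 * h2 + a / 6 * hb2)

/-- The constant is 18 · 27², from the denominators of a and b². -/
lemma formQ_eq_param (x y : ℂ) (hy : y ≠ 0) : formQ x y = 13122 * y ^ 24 *
    (-(paramA (x ^ 3 / y ^ 3) * (paramB (x ^ 3 / y ^ 3) ^ 2 + 24 * paramA (x ^ 3 / y ^ 3) ^ 3))) := by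
  unfold formQ paramA paramB
  field_simp
  ring

theorem isTypeNine_iff : IsTypeNine (fermatCubic ℂ) P ↔
    P.rep 0 ^ 3 + P.rep 1 ^ 3 + P.rep 2 ^ 3 = 0 ∧ formQ (P.rep 0) (P.rep 1) = 0 := by
  constructor
  · intro h
    have hP := isGeneral_of_isTypeNine h
    refine ⟨(fermatCubic_mem_pointIdeal ℂ P).1 hP.mem, ?_⟩
    rw [formQ_eq_param _ _ (hP.rep_ne_zero 1), ← cubeRatio, param_eq_zero_of_isTypeNine h]
    simp
  · rintro ⟨h1, h2⟩
    have hP : IsGeneral P := by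
      refine ⟨(fermatCubic_mem_pointIdeal ℂ P).2 h1, ?_⟩
      have hxy : P.rep 1 = 0 → P.rep 0 = 0 := fun h => by
        simpa [formQ, h] using h2
      have hyx : P.rep 0 = 0 → P.rep 1 = 0 := fun h => by
        simpa [formQ, h] using h2
      have hxz : P.rep 0 = 0 → P.rep 2 = 0 := fun h => by
        simpa [h, hyx h] using h1
      have hx : P.rep 0 ≠ 0 := fun h => P.rep_nonzero (by
        ext i; fin_cases i; exacts [h, hyx h, hxz h])
      have hz : P.rep 2 ≠ 0 := fun h => by
        have h3 : P.rep 1 ^ 3 = - P.rep 0 ^ 3 := by rw [h] at h1; linear_combination h1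
        -- As a polynomial in t = x³/y³, Q has value 1 at t = -1.
        have h4 : formQ (P.rep 0) (P.rep 1) = P.rep 0 ^ 24 := by
          have : formQ (P.rep 0) (P.rep 1) = P.rep 0 ^ 24 + 4 * P.rep 0 ^ 21 * P.rep 1 ^ 3 -
            17 * P.rep 0 ^ 18 * (P.rep 1 ^ 3) ^ 2 - 65 * P.rep 0 ^ 15 * (P.rep 1 ^ 3) ^ 3 -
            89 * P.rep 0 ^ 12 * (P.rep 1 ^ 3) ^ 4 - 65 * P.rep 0 ^ 9 * (P.rep 1 ^ 3) ^ 5 -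
            17 * P.rep 0 ^ 6 * (P.rep 1 ^ 3) ^ 6 + 4 * P.rep 0 ^ 3 * (P.rep 1 ^ 3) ^ 7 +
            (P.rep 1 ^ 3) ^ 8 := by unfold formQ; ring
          rw [this, h3]
          ring
        exact pow_ne_zero 24 hx (h4 ▸ h2)
      intro i
      fin_cases i
      exacts [hx, fun h => hx (hxy h), hz]
    refine hP.isTypeNine ?_
    rw [formQ_eq_param _ _ (hP.rep_ne_zero 1), ← cubeRatio] at h2
    have h3 := (mul_eq_zero.1 h2).resolve_left
      (mul_ne_zero (by norm_num) (pow_ne_zero 24 (hP.rep_ne_zero 1)))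
    exact neg_eq_zero.1 h3

end Classification

/-! ### Symmetry and splitting of Q. -/

section FormQ

variable {R : Type*} [CommRing R]

lemma formQ_mul_mul (x y t : R) : formQ (x * t) (y * t) = formQ x y * t ^ 24 := by
  unfold formQ
  ring

lemma map_formQ {S : Type*} [CommRing S] (f : R →+* S) (x y : R) :
    f (formQ x y) = formQ (f x) (f y) := by
  simp only [formQ, map_add, map_sub, map_mul, map_pow, map_ofNat]

lemma formQ_comm (x y : R) : formQ x y = formQ y x := by
  unfold formQ
  ring

/-- Q depends only on cubes, so x³ can be eliminated. With the symmetry of Q this makes all pairs of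
coordinates interchangeable on the curve. -/
lemma formQ_eq_of_add_eq_zero {x y z : R} (h : x ^ 3 + y ^ 3 + z ^ 3 = 0) :
    formQ x y = formQ y z := by
  have hx : x ^ 3 = -(y ^ 3 + z ^ 3) := by linear_combination h
  have h1 : formQ x y = (x ^ 3) ^ 8 + 4 * (x ^ 3) ^ 7 * y ^ 3 - 17 * (x ^ 3) ^ 6 * y ^ 6 -
      65 * (x ^ 3) ^ 5 * y ^ 9 - 89 * (x ^ 3) ^ 4 * y ^ 12 - 65 * (x ^ 3) ^ 3 * y ^ 15 -
      17 * (x ^ 3) ^ 2 * y ^ 18 + 4 * x ^ 3 * y ^ 21 + y ^ 24 := by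
    unfold formQ
    ring
  rw [h1, hx]
  unfold formQ
  ring

lemma isHomogeneous_formQ (k : Type*) [Field k] (i j : Fin 3) :
    (formQ (X i) (X j) : MvPolynomial (Fin 3) k).IsHomogeneous 24 := by
  have h : ∀ (c : ℕ) m n, m + n = 24 →
      ((c : MvPolynomial (Fin 3) k) * X i ^ m * X j ^ n).IsHomogeneous 24 := by
    intro c m n hmn
    have h1 := ((isHomogeneous_C (Fin 3) (c : k)).mul (isHomogeneous_X_pow (R := k) i m)).mul
      (isHomogeneous_X_pow (R := k) j n)
    rwa [map_natCast, zero_add, hmn] at h1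
  have h2 : (formQ (X i) (X j) : MvPolynomial (Fin 3) k) =
      ((1 : ℕ) : MvPolynomial (Fin 3) k) * X i ^ 24 * X j ^ 0 + ((4 : ℕ) : MvPolynomial (Fin 3) k) *
      X i ^ 21 * X j ^ 3 - ((17 : ℕ) : MvPolynomial (Fin 3) k) * X i ^ 18 * X j ^ 6 -
      ((65 : ℕ) : MvPolynomial (Fin 3) k) * X i ^ 15 * X j ^ 9 -
      ((89 : ℕ) : MvPolynomial (Fin 3) k) * X i ^ 12 * X j ^ 12 -
      ((65 : ℕ) : MvPolynomial (Fin 3) k) * X i ^ 9 * X j ^ 15 -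
      ((17 : ℕ) : MvPolynomial (Fin 3) k) * X i ^ 6 * X j ^ 18 +
      ((4 : ℕ) : MvPolynomial (Fin 3) k) * X i ^ 3 * X j ^ 21 +
      ((1 : ℕ) : MvPolynomial (Fin 3) k) * X i ^ 0 * X j ^ 24 := by
    unfold formQ
    push_cast
    ring
  rw [h2]
  exact ((((((((h 1 24 0 rfl).add (h 4 21 3 rfl)).sub (h 17 18 6 rfl)).sub (h 65 15 9 rfl)).sub
    (h 89 12 12 rfl)).sub (h 65 9 15 rfl)).sub (h 17 6 18 rfl)).add (h 4 3 21 rfl)).add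
    (h 1 0 24 rfl)

/-- The elements `τ i` are the `24` distinct roots of `Q(t, 1)`. -/
structure IsSplitting {k : Type} [Field k] (τ : Fin 24 → k) : Prop where
  injective : Function.Injective τ
  formQ_eq : ∀ {B : Type} [CommRing B] [Algebra k B] (x y : B),
    formQ x y = ∏ i, (x - algebraMap k B (τ i) * y)

lemma IsSplitting.map {k l : Type} [Field k] [Field l] [Algebra k l] {τ : Fin 24 → k}
    (h : IsSplitting τ) : IsSplitting (fun i => algebraMap k l (τ i)) where
  injective := (algebraMap k l).injective.comp h.injective
  formQ_eq := by
    intro B _ _ x y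
    let _ : Algebra k B := ((algebraMap l B).comp (algebraMap k l)).toAlgebra
    exact h.formQ_eq x y

lemma IsSplitting.formQ_eq_zero_iff {k : Type} [Field k] {τ : Fin 24 → k} (h : IsSplitting τ)
    (t : k) : formQ t 1 = 0 ↔ ∃ i, t = τ i := by
  rw [h.formQ_eq, Finset.prod_eq_zero_iff]
  simp [sub_eq_zero]

end FormQ

/-! ### Counting the points. -/

section Points

lemma exists_finset_cube_roots {w : ℂ} (hw : w ≠ 0) :
    ∃ s : Finset ℂ, s.card = 3 ∧ ∀ x, x ∈ s ↔ x ^ 3 = w := by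
  classical
  obtain ⟨x₀, hx₀⟩ := IsAlgClosed.exists_pow_nat_eq w (show 0 < 3 by norm_num)
  have h0 : x₀ ≠ 0 := by
    rintro rfl
    exact hw (by rw [← hx₀]; norm_num)
  refine ⟨(Polynomial.nthRootsFinset 3 (1 : ℂ)).image (· * x₀), ?_, fun x => ?_⟩
  · rw [Finset.card_image_of_injective _ (mul_left_injective₀ h0),
      (Complex.isPrimitiveRoot_exp 3 (by norm_num)).card_nthRootsFinset]
  · rw [Finset.mem_image]
    constructor
    · rintro ⟨y, hy, rfl⟩
      rw [Polynomial.mem_nthRootsFinset (by norm_num)] at hy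
      rw [mul_pow, hy, hx₀, one_mul]
    · intro hx
      refine ⟨x / x₀, ?_, div_mul_cancel₀ x h0⟩
      rw [Polynomial.mem_nthRootsFinset (by norm_num), div_pow, hx, hx₀, div_self hw]

lemma mk_mem_typeNinePoints_iff {v : Fin 3 → ℂ} (hv : v ≠ 0) :
    Projectivization.mk ℂ v hv ∈ typeNinePoints ↔
      v 0 ^ 3 + v 1 ^ 3 + v 2 ^ 3 = 0 ∧ formQ (v 0) (v 1) = 0 := by
  obtain ⟨a, ha⟩ := Projectivization.exists_smul_eq_mk_rep ℂ v hv
  have ha0 : (a : ℂ) ≠ 0 := a.ne_zero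
  have hr : ∀ i, (Projectivization.mk ℂ v hv).rep i = v i * a := fun i => by
    rw [← ha, mul_comm]
    rfl
  change IsTypeNine _ _ ↔ _
  rw [isTypeNine_iff, hr, hr, hr, formQ_mul_mul, mul_pow, mul_pow, mul_pow, ← add_mul, ← add_mul,
    mul_eq_zero, mul_eq_zero, or_iff_left (pow_ne_zero _ ha0), or_iff_left (pow_ne_zero _ ha0)]

lemma affine_ne_zero (x y : ℂ) : (![x, y, 1] : Fin 3 → ℂ) ≠ 0 := fun h =>
  one_ne_zero (congrFun h 2)

/-- The point `(x : y : 1)`. -/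
def affinePoint (x y : ℂ) : Plane := Projectivization.mk ℂ ![x, y, 1] (affine_ne_zero x y)

lemma affinePoint_injective {x y x' y' : ℂ} (h : affinePoint x y = affinePoint x' y') :
    x = x' ∧ y = y' := by
  obtain ⟨a, ha⟩ := (Projectivization.mk_eq_mk_iff' _ _ _ _ _).1 h
  have h2 := congrFun ha 2
  have h0 := congrFun ha 0
  have h1 := congrFun ha 1
  simp at h0 h1 h2
  subst h2
  exact ⟨by simpa using h0.symm, by simpa using h1.symm⟩

lemma affinePoint_mem_iff {x y : ℂ} : affinePoint x y ∈ typeNinePoints ↔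
    x ^ 3 + y ^ 3 + 1 = 0 ∧ formQ y 1 = 0 := by
  rw [affinePoint, mk_mem_typeNinePoints_iff]
  simp only [Matrix.cons_val, one_pow]
  refine and_congr_right fun h => ?_
  rw [formQ_eq_of_add_eq_zero (z := (1 : ℂ)) (by simpa using h)]

lemma exists_affinePoint {P : Plane} (hP : P ∈ typeNinePoints) : ∃ x y, P = affinePoint x y := by
  have h2 := (isGeneral_of_isTypeNine hP).rep_ne_zero 2
  refine ⟨P.rep 0 / P.rep 2, P.rep 1 / P.rep 2, ?_⟩
  conv_lhs => rw [← P.mk_rep]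
  rw [affinePoint, Projectivization.mk_eq_mk_iff']
  refine ⟨P.rep 2, ?_⟩
  ext i
  fin_cases i <;> simp <;> field_simp

variable {k : Type} [Field k] [Algebra k ℂ] {τ : Fin 24 → k}

lemma cube_add_one_ne_zero {y : ℂ} (hy : formQ y 1 = 0) : -(y ^ 3 + 1) ≠ 0 := by
  intro h
  have h1 : y ^ 3 = -1 := by linear_combination -h
  have h2 : formQ y 1 = (y ^ 3) ^ 8 + 4 * (y ^ 3) ^ 7 - 17 * (y ^ 3) ^ 6 -
      65 * (y ^ 3) ^ 5 - 89 * (y ^ 3) ^ 4 - 65 * (y ^ 3) ^ 3 -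
      17 * (y ^ 3) ^ 2 + 4 * y ^ 3 + 1 := by
    unfold formQ
    ring
  rw [h1, hy] at h2
  norm_num at h2

/-- Each of the 24 roots y leaves x³ = -(y³ + 1) ≠ 0, which has three solutions. -/
theorem ncard_typeNinePoints (hτ : IsSplitting τ) : typeNinePoints.ncard = 72 := by
  classical
  have hτ' := hτ.map (l := ℂ)
  have hroot : ∀ i, formQ (algebraMap k ℂ (τ i)) 1 = 0 := fun i =>
    (hτ'.formQ_eq_zero_iff _).2 ⟨i, rfl⟩
  choose s hs hs' using fun i => exists_finset_cube_roots (cube_add_one_ne_zero (hroot i))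
  have h1 : typeNinePoints = (fun p : Σ _ : Fin 24, ℂ => affinePoint p.2 (algebraMap k ℂ (τ p.1))) ''
      (Finset.univ.sigma s : Finset (Σ _ : Fin 24, ℂ)) := by
    ext P
    constructor
    · intro hP
      obtain ⟨x, y, rfl⟩ := exists_affinePoint hP
      obtain ⟨hx, hy⟩ := affinePoint_mem_iff.1 hP
      obtain ⟨i, rfl⟩ := (hτ'.formQ_eq_zero_iff _).1 hy
      refine ⟨⟨i, x⟩, ?_, rfl⟩
      simp only [Finset.coe_sigma, Set.mem_sigma_iff, Finset.coe_univ, Set.mem_univ, true_and,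
        Finset.mem_coe, hs']
      linear_combination hx
    · rintro ⟨⟨i, x⟩, hx, rfl⟩
      simp only [Finset.coe_sigma, Set.mem_sigma_iff, Finset.coe_univ, Set.mem_univ, true_and,
        Finset.mem_coe, hs'] at hx
      exact affinePoint_mem_iff.2 ⟨by linear_combination hx, hroot i⟩
  rw [h1, Set.ncard_image_of_injective, Set.ncard_coe_finset, Finset.card_sigma]
  · simp [hs]
  · rintro ⟨i, x⟩ ⟨j, y⟩ h
    obtain ⟨h2, h3⟩ := affinePoint_injective h
    obtain rfl := hτ'.injective h3
    obtain rfl : x = y := h2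
    rfl

/-- By the symmetry of Q on the curve, x is a root of Q(t, 1) as well as y. -/
lemma exists_coordinates (hτ : IsSplitting τ) {P : Plane} (hP : P ∈ typeNinePoints) :
    ∃ i j, P = affinePoint (algebraMap k ℂ (τ i)) (algebraMap k ℂ (τ j)) := by
  obtain ⟨x, y, rfl⟩ := exists_affinePoint hP
  obtain ⟨hx, hy⟩ := affinePoint_mem_iff.1 hP
  obtain ⟨j, rfl⟩ := ((hτ.map (l := ℂ)).formQ_eq_zero_iff _).1 hy
  have hx' : formQ x 1 = 0 := by
    rw [formQ_comm, ← formQ_eq_of_add_eq_zero (x := algebraMap k ℂ (τ j)), hy]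
    linear_combination hx
  obtain ⟨i, rfl⟩ := ((hτ.map (l := ℂ)).formQ_eq_zero_iff _).1 hx'
  exact ⟨i, j, rfl⟩

end Points

/-! ### The homogeneous ideal and the regular sequence. -/

section IdealOfPoints

variable {k : Type} [Field k]

/-- The Fermat cubic as a monic polynomial in the first variable. -/
def monicCubic (k : Type) [Field k] : Polynomial (MvPolynomial (Fin 2) k) :=
  Polynomial.X ^ 3 + Polynomial.C (X 0 ^ 3 + X 1 ^ 3)

lemma monic_monicCubic : (monicCubic k).Monic := Polynomial.monic_X_pow_add_C _ (by norm_num)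

lemma natDegree_monicCubic : (monicCubic k).natDegree = 3 := Polynomial.natDegree_X_pow_add_C

lemma finSuccEquiv_formQ : finSuccEquiv k 2 (formQ (X 1) (X 2)) =
    Polynomial.C (formQ (X 0) (X 1)) := by
  have h1 := map_formQ (finSuccEquiv k 2).toRingEquiv.toRingHom (X 1) (X 2)
  have h2 := map_formQ (Polynomial.C : MvPolynomial (Fin 2) k →+* _) (X 0) (X 1)
  rw [h2]
  refine h1.trans ?_
  exact congrArg₂ formQ (finSuccEquiv_X_succ (j := 0)) (finSuccEquiv_X_succ (j := 1))

lemma mem_span_fermatCubic_iff (f : MvPolynomial (Fin 3) k) :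
    f ∈ Ideal.span {fermatCubic k} ↔ finSuccEquiv k 2 f %ₘ monicCubic k = 0 := by
  rw [Ideal.mem_span_singleton, Polynomial.modByMonic_eq_zero_iff_dvd monic_monicCubic,
    monicCubic, ← finSuccEquiv_fermatCubic]
  exact (map_dvd_iff (finSuccEquiv k 2)).symm

lemma mem_span_of_formQ_dvd {f : MvPolynomial (Fin 3) k}
    (h : ∀ n, formQ (X 0) (X 1) ∣ (finSuccEquiv k 2 f %ₘ monicCubic k).coeff n) :
    f ∈ Ideal.span {fermatCubic k, formQ (X 1) (X 2)} := by
  obtain ⟨r, hr⟩ := (Polynomial.C_dvd_iff_dvd_coeff _ _).2 h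
  have h1 := Polynomial.modByMonic_add_div (finSuccEquiv k 2 f) (monicCubic k)
  rw [hr, ← finSuccEquiv_formQ, monicCubic, ← finSuccEquiv_fermatCubic] at h1
  obtain ⟨r', rfl⟩ := (finSuccEquiv k 2).surjective r
  obtain ⟨q', hq'⟩ := (finSuccEquiv k 2).surjective
    (finSuccEquiv k 2 f /ₘ finSuccEquiv k 2 (fermatCubic k))
  rw [← hq', ← map_mul, ← map_mul, ← map_add] at h1
  rw [Ideal.mem_span_pair]
  refine ⟨q', r', ?_⟩
  rw [← (finSuccEquiv k 2).injective h1]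
  ring

open scoped Pointwise in
-- F is monic in x and Q(y, z) is free of x, so multiplying by Q multiplies the remainder modulo F
-- by Q. Properness holds as both forms vanish at the origin.
lemma isRegular_fermatCubic_formQ : RingTheory.Sequence.IsRegular (MvPolynomial (Fin 3) k)
    [fermatCubic k, formQ (X 1) (X 2)] := by
  have hQ : (formQ (X 0) (X 1) : MvPolynomial (Fin 2) k) ≠ 0 := by
    intro h
    have := congrArg (eval ![(1 : k), 0]) h
    simp [formQ] at this
  have hF : fermatCubic k ≠ 0 := by
    intro h
    have := congrArg (eval ![(1 : k), 0, 0]) h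
    simp [fermatCubic] at this
  refine ⟨?_, ?_⟩
  · rw [RingTheory.Sequence.isWeaklyRegular_cons_iff,
      RingTheory.Sequence.isWeaklyRegular_singleton_iff]
    refine ⟨fun x y hxy => mul_left_cancel₀ hF hxy, ?_⟩
    refine (isSMulRegular_quotient_iff_mem_of_smul_mem _ _).2 ?_
    intro f hf
    have hspan : (fermatCubic k • ⊤ : Submodule (MvPolynomial (Fin 3) k) (MvPolynomial (Fin 3) k))
        = Ideal.span {fermatCubic k} := by
      rw [← Submodule.ideal_span_singleton_smul, smul_eq_mul, Ideal.mul_top]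
    rw [hspan] at hf ⊢
    rw [mem_span_fermatCubic_iff, smul_eq_mul, map_mul, finSuccEquiv_formQ,
      Polynomial.C_mul', Polynomial.smul_modByMonic] at hf
    rw [mem_span_fermatCubic_iff]
    exact (smul_eq_zero.1 hf).resolve_left hQ
  · intro h
    have h1 : (1 : MvPolynomial (Fin 3) k) ∈ RingHom.ker (eval (0 : Fin 3 → k)) := by
      have h2 : Ideal.ofList [fermatCubic k, formQ (X 1) (X 2)] ≤
          RingHom.ker (eval (0 : Fin 3 → k)) := by
        rw [Ideal.ofList, Ideal.span_le]
        intro x hx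
        simp only [List.mem_cons, List.not_mem_nil, or_false, Set.mem_ofPred_eq] at hx
        rcases hx with rfl | rfl <;> simp [fermatCubic, formQ]
      apply h2
      have h3 : (1 : MvPolynomial (Fin 3) k) ∈ (⊤ : Submodule (MvPolynomial (Fin 3) k)
        (MvPolynomial (Fin 3) k)) := trivial
      rw [h, smul_eq_mul, Ideal.mul_top] at h3
      exact h3
    simp at h1

variable [Algebra k ℂ] {τ : Fin 24 → k}

lemma mem_pointIdeal_mk {v : Fin 3 → ℂ} {hv : v ≠ 0} {f : MvPolynomial (Fin 3) k}
    (hf : f ∈ pointIdeal k (Projectivization.mk ℂ v hv)) :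
    aeval (fun i => Polynomial.C (v i) * Polynomial.X : Fin 3 → Polynomial ℂ) f = 0 := by
  obtain ⟨a, ha⟩ := Projectivization.exists_smul_eq_mk_rep ℂ v hv
  rw [mem_pointIdeal, ← ha] at hf
  have h1 : (aeval (fun i => Polynomial.C (v i) * Polynomial.X : Fin 3 → Polynomial ℂ) :
      MvPolynomial (Fin 3) k →ₐ[k] _) =
      ((Polynomial.aeval (Polynomial.C (a : ℂ)⁻¹ * Polynomial.X :
        Polynomial ℂ)).restrictScalars k).comp
      (aeval (fun i => Polynomial.C ((a • v) i) * Polynomial.X : Fin 3 → Polynomial ℂ)) := by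
    apply MvPolynomial.algHom_ext
    intro i
    simp only [AlgHom.comp_apply, aeval_X, map_mul, AlgHom.restrictScalars_apply,
      Polynomial.aeval_X, Polynomial.aeval_C, Pi.smul_apply, Units.smul_def, smul_eq_mul]
    rw [← Polynomial.C_eq_algebraMap]
    have : (Polynomial.C (a : ℂ) * Polynomial.C (a : ℂ)⁻¹ : Polynomial ℂ) = 1 := by
      rw [← Polynomial.C_mul, mul_inv_cancel₀ a.ne_zero, Polynomial.C_1]
    linear_combination (-Polynomial.C (v i) * Polynomial.X) * this
  rw [h1, AlgHom.comp_apply, hf, map_zero]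

/-- As a polynomial in its first variable, `c` has the 24 distinct roots τᵢ times the second
variable. -/
lemma formQ_dvd_of_eval_eq_zero (hτ : IsSplitting τ) {c : MvPolynomial (Fin 2) k}
    (hc : ∀ i, aeval ![Polynomial.C (algebraMap k ℂ (τ i)) * Polynomial.X,
      (Polynomial.X : Polynomial ℂ)] c = 0) : formQ (X 0) (X 1) ∣ c := by
  rw [← map_dvd_iff (finSuccEquiv k 1)]
  have h1 : finSuccEquiv k 1 (formQ (X 0) (X 1)) =
      ∏ i, (Polynomial.X - Polynomial.C (C (τ i) * X 0)) := by
    rw [hτ.formQ_eq, map_prod]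
    refine Finset.prod_congr rfl fun i _ => ?_
    rw [map_sub, map_mul, finSuccEquiv_X_zero, show (1 : Fin 2) = Fin.succ 0 from rfl,
      finSuccEquiv_X_succ, AlgEquiv.commutes, Polynomial.C_mul]
    rfl
  rw [h1]
  by_cases h0 : finSuccEquiv k 1 c = 0
  · rw [h0]
    exact dvd_zero _
  have hinj : Function.Injective fun i => (C (τ i) * X 0 : MvPolynomial (Fin 1) k) := by
    intro i j hij
    have := congrArg (eval (1 : Fin 1 → k)) hij
    simpa using hτ.injective (by simpa using this)
  have h2 := (Multiset.prod_X_sub_C_dvd_iff_le_roots h0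
    ((Finset.univ : Finset (Fin 24)).val.map fun i => (C (τ i) * X 0 : MvPolynomial (Fin 1) k))).2 ?_
  · rwa [Multiset.map_map] at h2
  · rw [Multiset.le_iff_subset (Finset.univ.nodup.map hinj)]
    intro r hr
    obtain ⟨i, -, rfl⟩ := Multiset.mem_map.1 hr
    rw [Polynomial.mem_roots h0, Polynomial.IsRoot]
    have hη : Function.Injective
        (aeval (fun _ => Polynomial.X) : MvPolynomial (Fin 1) k →ₐ[k] Polynomial ℂ) := by
      refine algebraicIndependent_unique_type_iff.2 ?_
      rw [transcendental_iff]
      intro p hp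
      rw [Polynomial.aeval_X_left_eq_map] at hp
      exact (Polynomial.map_eq_zero _).1 hp
    apply hη
    rw [map_zero, ← hc i]
    have h3 : ((aeval (fun _ => Polynomial.X) : MvPolynomial (Fin 1) k →ₐ[k] Polynomial ℂ).comp
        ((Polynomial.aeval (C (τ i) * X 0 : MvPolynomial (Fin 1) k)).restrictScalars k)).comp
        (finSuccEquiv k 1).toAlgHom = aeval ![Polynomial.C (algebraMap k ℂ (τ i)) * Polynomial.X,
      (Polynomial.X : Polynomial ℂ)] := by
      apply MvPolynomial.algHom_ext
      intro j
      fin_cases j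
      · change aeval _ (Polynomial.aeval (C (τ i) * X 0 : MvPolynomial (Fin 1) k)
          (finSuccEquiv k 1 (X 0))) = _
        rw [finSuccEquiv_X_zero, Polynomial.aeval_X, map_mul, algHom_C, aeval_X, aeval_X]
        rfl
      · change aeval _ (Polynomial.aeval (C (τ i) * X 0 : MvPolynomial (Fin 1) k)
          (finSuccEquiv k 1 (X (Fin.succ 0)))) = _
        rw [finSuccEquiv_X_succ, Polynomial.aeval_C, Algebra.algebraMap_self, RingHom.id_apply,
          aeval_X, aeval_X]
        rfl
    rw [← h3]
    change _ = aeval _ (Polynomial.aeval (C (τ i) * X 0 : MvPolynomial (Fin 1) k)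
      (finSuccEquiv k 1 c))
    rw [Polynomial.coe_aeval_eq_eval]

theorem idealOfPoints_typeNinePoints (hτ : IsSplitting τ) :
    idealOfPoints k typeNinePoints = Ideal.span {fermatCubic k, formQ (X 1) (X 2)} := by
  apply le_antisymm
  · intro f hf
    have hf' : ∀ P ∈ typeNinePoints, f ∈ pointIdeal k P := by
      simpa [idealOfPoints, Ideal.mem_iInf] using hf
    refine mem_span_of_formQ_dvd fun n => formQ_dvd_of_eval_eq_zero hτ fun i => ?_
    have hroot : formQ (algebraMap k ℂ (τ i)) 1 = 0 :=
      (hτ.map.formQ_eq_zero_iff _).2 ⟨i, rfl⟩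
    obtain ⟨s, hs, hs'⟩ := exists_finset_cube_roots (cube_add_one_ne_zero hroot)
    set ψ : MvPolynomial (Fin 2) k →ₐ[k] Polynomial ℂ :=
      aeval ![Polynomial.C (algebraMap k ℂ (τ i)) * Polynomial.X, (Polynomial.X : Polynomial ℂ)]
      with hψ
    set r := finSuccEquiv k 2 f %ₘ monicCubic k with hr
    -- Along y = τᵢz the remainder has degree at most 2 in x but vanishes at three points.
    have hzero : r.map ψ.toRingHom = 0 := by
      classical
      refine Polynomial.eq_zero_of_natDegree_lt_card_of_eval_eq_zero' _
        (s.image fun x => Polynomial.C x * Polynomial.X) ?_ ?_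
      · intro y hy
        obtain ⟨x, hx, rfl⟩ := Finset.mem_image.1 hy
        rw [hs'] at hx
        have hmem : affinePoint x (algebraMap k ℂ (τ i)) ∈ typeNinePoints :=
          affinePoint_mem_iff.2 ⟨by linear_combination hx, hroot⟩
        have h1 := mem_pointIdeal_mk (hf' _ hmem)
        set θ : MvPolynomial (Fin 3) k →ₐ[k] Polynomial ℂ := aeval (fun j => Polynomial.C
          ((![x, algebraMap k ℂ (τ i), 1] : Fin 3 → ℂ) j) * Polynomial.X) with hθ
        have h2 : ∀ g : MvPolynomial (Fin 3) k, θ g =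
            Polynomial.eval₂ ψ.toRingHom (Polynomial.C x * Polynomial.X) (finSuccEquiv k 2 g) := by
          intro g
          have : θ.toRingHom = (Polynomial.eval₂RingHom ψ.toRingHom
              (Polynomial.C x * Polynomial.X)).comp (finSuccEquiv k 2).toRingEquiv.toRingHom := by
            apply MvPolynomial.ringHom_ext
            · intro c
              change θ (C c) = Polynomial.eval₂ ψ.toRingHom (Polynomial.C x * Polynomial.X)
                (finSuccEquiv k 2 (C c))
              rw [algHom_C, show finSuccEquiv k 2 (C c) = Polynomial.C (C c) from
                (finSuccEquiv k 2).commutes c, Polynomial.eval₂_C]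
              exact (algHom_C ψ c).symm
            · intro j
              change θ (X j) = Polynomial.eval₂ ψ.toRingHom (Polynomial.C x * Polynomial.X)
                (finSuccEquiv k 2 (X j))
              rw [hθ, aeval_X]
              fin_cases j
              · change _ = Polynomial.eval₂ _ _ (finSuccEquiv k 2 (X 0))
                rw [finSuccEquiv_X_zero, Polynomial.eval₂_X]
                rfl
              · change _ = Polynomial.eval₂ _ _ (finSuccEquiv k 2 (X (Fin.succ 0)))
                rw [finSuccEquiv_X_succ, Polynomial.eval₂_C]
                change _ = ψ (X 0)
                rw [hψ, aeval_X]
                rfl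
              · change _ = Polynomial.eval₂ _ _ (finSuccEquiv k 2 (X (Fin.succ 1)))
                rw [finSuccEquiv_X_succ, Polynomial.eval₂_C]
                change _ = ψ (X 1)
                rw [hψ, aeval_X]
                simp
          exact congrArg (fun φ => φ g) this
        have h3 : θ (fermatCubic k) = 0 :=
          mem_pointIdeal_mk ((fermatCubic_mem_pointIdeal k _).2 (isTypeNine_iff.1 hmem).1)
        rw [Polynomial.eval_map]
        rw [h2] at h1 h3
        rw [finSuccEquiv_fermatCubic] at h3
        rw [← Polynomial.modByMonic_add_div (finSuccEquiv k 2 f) (monicCubic k),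
          Polynomial.eval₂_add, Polynomial.eval₂_mul] at h1
        rwa [show Polynomial.eval₂ ψ.toRingHom (Polynomial.C x * Polynomial.X) (monicCubic k) = 0
          from h3, zero_mul, add_zero] at h1
      · rw [Finset.card_image_of_injective, hs]
        · refine lt_of_le_of_lt Polynomial.natDegree_map_le ?_
          have := Polynomial.natDegree_modByMonic_lt (finSuccEquiv k 2 f) monic_monicCubic
            (fun h => by have := congrArg Polynomial.natDegree h; simp [natDegree_monicCubic] at this)
          rwa [natDegree_monicCubic] at this
        · intro x y hxy
          exact Polynomial.C_injective (mul_right_cancel₀ Polynomial.X_ne_zero hxy)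
    have := congrArg (fun p => Polynomial.coeff p n) hzero
    simpa using this
  · rw [Ideal.span_le]
    intro f hf
    have h : ∀ P ∈ typeNinePoints, f ∈ pointIdeal k P := by
      intro P hP
      obtain ⟨h1, h2⟩ := isTypeNine_iff.1 hP
      rcases hf with rfl | rfl
      · exact (fermatCubic_mem_pointIdeal k P).2 h1
      · rw [mem_pointIdeal_of_isHomogeneous (isHomogeneous_formQ k 1 2)]
        refine (map_formQ (aeval P.rep : MvPolynomial (Fin 3) k →ₐ[k] ℂ).toRingHom _ _).trans ?_
        rw [formQ_eq_of_add_eq_zero h1] at h2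
        simpa using h2
    simpa [idealOfPoints, Ideal.mem_iInf] using h

lemma span_formQ_eq (k : Type) [Field k] {i j l : Fin 3}
    (h : (X i ^ 3 + X j ^ 3 + X l ^ 3 : MvPolynomial (Fin 3) k) = fermatCubic k) :
    Ideal.span {fermatCubic k, formQ (X i) (X j)} =
      Ideal.span {fermatCubic k, formQ (X j) (X l)} := by
  obtain ⟨I, hI⟩ : ∃ I : Ideal (MvPolynomial (Fin 3) k), I = Ideal.span {fermatCubic k} := ⟨_, rfl⟩
  have h1 : (formQ (X i) (X j) - formQ (X j) (X l) : MvPolynomial (Fin 3) k) ∈ I := by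
    rw [← Ideal.Quotient.eq_zero_iff_mem, map_sub, map_formQ (Ideal.Quotient.mk I),
      map_formQ (Ideal.Quotient.mk I), sub_eq_zero]
    refine formQ_eq_of_add_eq_zero (R := MvPolynomial (Fin 3) k ⧸ I) ?_
    rw [← map_pow, ← map_pow, ← map_pow, ← map_add, ← map_add, Ideal.Quotient.eq_zero_iff_mem, h, hI]
    exact Ideal.mem_span_singleton_self _
  obtain ⟨c, hc⟩ := Ideal.mem_span_singleton.1 (hI ▸ h1)
  have h2 : (formQ (X i) (X j) : MvPolynomial (Fin 3) k) =
      formQ (X j) (X l) + c * fermatCubic k := by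
    linear_combination hc
  rw [h2]
  exact Ideal.span_pair_add_mul_left (x := fermatCubic k) (y := formQ (X j) (X l)) c

lemma isCompleteIntersection_typeNinePoints (hτ : IsSplitting τ) :
    IsCompleteIntersection k typeNinePoints 3 24 :=
  ⟨_, _, isHomogeneous_fermatCubic k, isHomogeneous_formQ k 1 2, isRegular_fermatCubic_formQ,
    idealOfPoints_typeNinePoints hτ⟩

end IdealOfPoints

/-! ### The roots of Q in ℚ(α, β). -/

section Splitting

/-- One root of `Q(t, 1)` from each class of roots with the same cube. -/
def cubeRoot {k : Type} [Field k] (α β : k) : Fin 8 → k :=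
  ![β, β ^ 2, (β + β ^ 8 - β ^ 4 - β ^ 5) / α ^ 2, (β ^ 2 + β ^ 7 - β - β ^ 8) / α ^ 2,
    (β ^ 4 + β ^ 5 - β ^ 2 - β ^ 7) / α ^ 2, α ^ 2 / (β + β ^ 8 - β ^ 4 - β ^ 5),
    α ^ 2 / (β ^ 2 + β ^ 7 - β - β ^ 8), α ^ 2 / (β ^ 4 + β ^ 5 - β ^ 2 - β ^ 7)]

/-- The `24` roots of `Q(t, 1)`. -/
def rootQ {k : Type} [Field k] (α β : k) (i : Fin 24) : k :=
  β ^ (3 * ((finProdFinEquiv (m := 8) (n := 3)).symm i).2 : ℕ) *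
    cubeRoot α β ((finProdFinEquiv (m := 8) (n := 3)).symm i).1

variable {k : Type} [Field k] {α β : k}

lemma prod_sub_mul {B : Type} [CommRing B] {w : B} (hw : 1 + w + w ^ 2 = 0) (x y s : B) :
    ∏ i : Fin 3, (x - w ^ (i : ℕ) * s * y) = x ^ 3 - s ^ 3 * y ^ 3 := by
  have h3 : w ^ 3 = 1 := by linear_combination (w - 1) * hw
  rw [Fin.prod_univ_three]
  simp only [Fin.val_zero, Fin.val_one, Fin.val_two]
  linear_combination (-x ^ 2 * s * y + x * s ^ 2 * y ^ 2 * w) * hw - s ^ 3 * y ^ 3 * h3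

lemma formQ_eq_mul {B : Type} [CommRing B] (x y : B) : formQ x y =
    (x ^ 9 - 3 * x ^ 6 * y ^ 3 - 6 * x ^ 3 * y ^ 6 - y ^ 9) * (x ^ 6 + x ^ 3 * y ^ 3 + y ^ 6) *
      (x ^ 9 + 6 * x ^ 6 * y ^ 3 + 3 * x ^ 3 * y ^ 6 - y ^ 9) := by
  unfold formQ
  ring

/-- `Q` as a product of cubic factors. -/
lemma formQ_eq_prod_cubes {B : Type} [CommRing B] [Algebra k B] (hα : α ^ 3 = 3)
    (h3 : (3 : k) ≠ 0) (hβ : 1 + β ^ 3 + β ^ 6 = 0) (x y : B) :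
    formQ x y = ∏ j, (x ^ 3 - algebraMap k B (cubeRoot α β j) ^ 3 * y ^ 3) := by
  -- For β a primitive ninth root of unity these are differences of the numbers β + β⁸, β² + β⁷, β⁴
  -- + β⁵. They are the roots of s³ - 9s - 9, which is l³ - 3l² - 6l - 1 at l = 1 + s.
  obtain ⟨s1, hs1⟩ : ∃ s, s = β + β ^ 8 - β ^ 4 - β ^ 5 := ⟨_, rfl⟩
  obtain ⟨s2, hs2⟩ : ∃ s, s = β ^ 2 + β ^ 7 - β - β ^ 8 := ⟨_, rfl⟩
  obtain ⟨s3, hs3⟩ : ∃ s, s = β ^ 4 + β ^ 5 - β ^ 2 - β ^ 7 := ⟨_, rfl⟩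
  have e1 : s1 + s2 + s3 = 0 := by rw [hs1, hs2, hs3]; ring
  have e2 : s1 * s2 + s1 * s3 + s2 * s3 = -9 := by
    rw [hs1, hs2, hs3]
    linear_combination ((9)*β^0 + (-1)*β^2 + (-8)*β^3 + (-1)*β^4 + (2)*β^5 + (1)*β^6 + (2)*β^7 + (-1)*β^8 + (1)*β^9 + (-1)*β^10) * hβ
  have e3 : s1 * s2 * s3 = 9 := by
    rw [hs1, hs2, hs3]
    linear_combination ((-9)*β^0 + (9)*β^3 + (1)*β^4 + (-1)*β^5 + (-1)*β^6 + (-2)*β^7 + (2)*β^8 + (-5)*β^9 + (4)*β^12 + (2)*β^13 + (-2)*β^14 + (-1)*β^15 + (-1)*β^16 + (1)*β^17) * hβ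
  -- From s³ = 9(1 + s) and α⁶ = 9, the number 1 + s is the cube of s/α².
  have hcub : ∀ s, (s - s1) * (s - s2) * (s - s3) = 0 → s ≠ 0 ∧ (s / α ^ 2) ^ 3 = 1 + s := by
    intro s hs
    have h9 : s ^ 3 = 9 * (1 + s) := by
      linear_combination hs + s ^ 2 * e1 - s * e2 + e3
    have h99 : (9 : k) ≠ 0 := by
      rw [show (9 : k) = 3 * 3 by norm_num]
      exact mul_ne_zero h3 h3
    refine ⟨fun h0 => h99 ?_, ?_⟩
    · rw [h0] at h9
      linear_combination -h9
    · rw [div_pow, h9, ← pow_mul, show α ^ (2 * 3) = 9 by linear_combination (α ^ 3 + 3) * hα,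
        mul_div_cancel_left₀ _ h99]
  obtain ⟨n1, c1⟩ := hcub s1 (by ring)
  obtain ⟨n2, c2⟩ := hcub s2 (by ring)
  obtain ⟨n3, c3⟩ := hcub s3 (by ring)
  -- The cubes attached to the last factor of Q are the inverses of the 1 + sᵢ, hence products of
  -- two of them.
  have ht : (1 + s1) * (1 + s2) * (1 + s3) = 1 := by linear_combination e1 + e2 + e3
  have d1 : (α ^ 2 / s1) ^ 3 = (1 + s2) * (1 + s3) := by
    rw [← inv_div, inv_pow, c1]
    exact inv_eq_of_mul_eq_one_right (by linear_combination ht)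
  have d2 : (α ^ 2 / s2) ^ 3 = (1 + s1) * (1 + s3) := by
    rw [← inv_div, inv_pow, c2]
    exact inv_eq_of_mul_eq_one_right (by linear_combination ht)
  have d3 : (α ^ 2 / s3) ^ 3 = (1 + s1) * (1 + s2) := by
    rw [← inv_div, inv_pow, c3]
    exact inv_eq_of_mul_eq_one_right (by linear_combination ht)
  simp only [← map_pow, Fin.prod_univ_succ, Fin.prod_univ_zero, cubeRoot, Matrix.cons_val_zero,
    Matrix.cons_val_succ, ← hs1, ← hs2, ← hs3, c1, c2, c3, d1, d2, d3]
  rw [show (β ^ 2) ^ 3 = -1 - β ^ 3 by linear_combination hβ]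
  have E1 := congrArg (algebraMap k B) e1
  have E2 := congrArg (algebraMap k B) e2
  have E3 := congrArg (algebraMap k B) e3
  have Eβ := congrArg (algebraMap k B) hβ
  simp only [map_add, map_sub, map_mul, map_neg, map_one, map_zero, map_ofNat, map_pow]
    at E1 E2 E3 Eβ ⊢
  generalize algebraMap k B s1 = S1 at *
  generalize algebraMap k B s2 = S2 at *
  generalize algebraMap k B s3 = S3 at *
  generalize algebraMap k B β = b at *
  have f1 : (x ^ 3 - b ^ 3 * y ^ 3) * (x ^ 3 - (-1 - b ^ 3) * y ^ 3) =
      x ^ 6 + x ^ 3 * y ^ 3 + y ^ 6 := by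
    linear_combination -y ^ 6 * Eβ
  have f2 : (x ^ 3 - (1 + S1) * y ^ 3) * (x ^ 3 - (1 + S2) * y ^ 3) * (x ^ 3 - (1 + S3) * y ^ 3) =
      x ^ 9 - 3 * x ^ 6 * y ^ 3 - 6 * x ^ 3 * y ^ 6 - y ^ 9 := by
    linear_combination (-x ^ 6 * y ^ 3 + 2 * x ^ 3 * y ^ 6 - y ^ 9) * E1 +
      (x ^ 3 * y ^ 6 - y ^ 9) * E2 - y ^ 9 * E3
  have f3 : (x ^ 3 - (1 + S2) * (1 + S3) * y ^ 3) * (x ^ 3 - (1 + S1) * (1 + S3) * y ^ 3) *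
      (x ^ 3 - (1 + S1) * (1 + S2) * y ^ 3) =
      x ^ 9 + 6 * x ^ 6 * y ^ 3 + 3 * x ^ 3 * y ^ 6 - y ^ 9 := by
    have hT : (1 + S1) * (1 + S2) * (1 + S3) = 1 := by linear_combination E1 + E2 + E3
    have hT2 : (1 + S2) * (1 + S3) + (1 + S1) * (1 + S3) + (1 + S1) * (1 + S2) = -6 := by
      linear_combination 2 * E1 + E2
    linear_combination -x ^ 6 * y ^ 3 * hT2 + x ^ 3 * y ^ 6 * ((1 + S1) * (1 + S2) * (1 + S3)) * E1 +
      3 * x ^ 3 * y ^ 6 * hT - y ^ 9 * ((1 + S1) * (1 + S2) * (1 + S3) + 1) * hT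
  rw [formQ_eq_mul, ← f1, ← f2, ← f3]
  ring

lemma formQ_eq_prod {B : Type} [CommRing B] [Algebra k B] (hα : α ^ 3 = 3)
    (h3 : (3 : k) ≠ 0) (hβ : 1 + β ^ 3 + β ^ 6 = 0) (x y : B) :
    formQ x y = ∏ i, (x - algebraMap k B (rootQ α β i) * y) := by
  have hw : 1 + algebraMap k B β ^ 3 + (algebraMap k B β ^ 3) ^ 2 = 0 := by
    rw [← map_pow, ← map_pow, ← map_one (algebraMap k B), ← map_add, ← map_add, ← pow_mul, hβ,
      map_zero]
  rw [formQ_eq_prod_cubes hα h3 hβ, ← (finProdFinEquiv (m := 8) (n := 3)).prod_comp,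
    Fintype.prod_prod_type]
  refine Finset.prod_congr rfl fun j _ => ?_
  rw [← prod_sub_mul hw]
  refine Finset.prod_congr rfl fun m _ => ?_
  rw [rootQ, Equiv.symm_apply_apply, map_mul, map_pow, pow_mul]

/-- The polynomial `Q(t, 1)` has no multiple roots. -/
lemma formQ_separable (h3 : (3 : k) ≠ 0) {t : k} (h0 : formQ t 1 = 0)
    (h1 : 24 * t ^ 23 + 84 * t ^ 20 - 306 * t ^ 17 - 975 * t ^ 14 - 1068 * t ^ 11 - 585 * t ^ 8 -
      102 * t ^ 5 + 12 * t ^ 2 = 0) : False := by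
  have ht : t ≠ 0 := by
    rintro rfl
    simp [formQ] at h0
  obtain ⟨l, hl⟩ : ∃ l, l = t ^ 3 := ⟨_, rfl⟩
  have e0 : l ^ 8 + 4 * l ^ 7 - 17 * l ^ 6 - 65 * l ^ 5 - 89 * l ^ 4 - 65 * l ^ 3 - 17 * l ^ 2 +
      4 * l + 1 = 0 := by
    rw [hl, ← h0]
    unfold formQ
    ring
  have e1 : 8 * l ^ 7 + 28 * l ^ 6 - 102 * l ^ 5 - 325 * l ^ 4 - 356 * l ^ 3 - 195 * l ^ 2 - 34 * l +
      4 = 0 := by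
    apply (mul_eq_zero.1 _).resolve_left (mul_ne_zero h3 (pow_ne_zero 2 ht))
    rw [hl, ← h1]
    ring
  -- A Bézout identity between the degree 8 polynomial in l = t³ and its derivative.
  have h : (3 : k) ^ 9 = 0 := by
    linear_combination ((3335)*l^0 + (144462)*l^1 + (334398)*l^2 + (368768)*l^3 + (156624)*l^4 + (-33312)*l^5 + (-11104)*l^6) * e0 + ((4087)*l^0 + (-4711)*l^1 + (-54690)*l^2 + (-89216)*l^3 + (-76705)*l^4 + (-25824)*l^5 + (4858)*l^6 + (1388)*l^7) * e1
  exact pow_ne_zero 9 h3 h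

lemma isSplitting_rootQ (hα : α ^ 3 = 3) (h3 : (3 : k) ≠ 0) (hβ : 1 + β ^ 3 + β ^ 6 = 0) :
    IsSplitting (rootQ α β) := by
  refine ⟨fun i j hij => ?_, fun x y => formQ_eq_prod hα h3 hβ x y⟩
  -- Two equal roots would give Q(t, 1) a double root.
  by_contra hne
  have h1 := formQ_eq_prod (B := Polynomial k) hα h3 hβ Polynomial.X 1
  rw [← Finset.mul_prod_erase _ _ (Finset.mem_univ i),
    ← Finset.mul_prod_erase _ _ (Finset.mem_erase.2 ⟨Ne.symm hne, Finset.mem_univ j⟩), ← hij,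
    ← mul_assoc, mul_one, ← Polynomial.C_eq_algebraMap] at h1
  obtain ⟨g, hg⟩ : ∃ g, formQ Polynomial.X 1 = (Polynomial.X - Polynomial.C (rootQ α β i)) *
    (Polynomial.X - Polynomial.C (rootQ α β i)) * g := ⟨_, h1⟩
  have h0 := congrArg (Polynomial.eval (rootQ α β i)) hg
  have h2 := congrArg (fun p => Polynomial.eval (rootQ α β i) (Polynomial.derivative p)) hg
  refine formQ_separable h3 (t := rootQ α β i) ?_ ?_
  · simp [formQ] at h0 ⊢
    linear_combination h0
  · simp [formQ] at h2
    linear_combination h2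

end Splitting

end FermatTypeNine

end

/-! ### The main theorem. -/

theorem mainTheorem2 (α β : ℂ) (hα : α ^ 3 = 3) (hβ : IsPrimitiveRoot β 9)
    (K : IntermediateField ℚ ℂ) (hK : K = IntermediateField.adjoin ℚ {α, β}) :
    -- there are 72 points of type 9, all with coordinates in `K = ℚ(α, β)`
    FermatTypeNine.typeNinePoints.ncard = 72 ∧
    (∀ P ∈ FermatTypeNine.typeNinePoints, ∃ (w : Fin 3 → K) (hw : (fun i => (w i : ℂ)) ≠ 0),
      P = Projectivization.mk ℂ (fun i => (w i : ℂ)) hw) ∧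
    -- the ideal of these points is `(F, Q(x, y)) = (F, Q(x, z)) = (F, Q(y, z))`
    FermatTypeNine.idealOfPoints K FermatTypeNine.typeNinePoints =
      Ideal.span {FermatTypeNine.fermatCubic K,
        FermatTypeNine.formQ (MvPolynomial.X 0) (MvPolynomial.X 1)} ∧
    FermatTypeNine.idealOfPoints K FermatTypeNine.typeNinePoints =
      Ideal.span {FermatTypeNine.fermatCubic K,
        FermatTypeNine.formQ (MvPolynomial.X 0) (MvPolynomial.X 2)} ∧
    FermatTypeNine.idealOfPoints K FermatTypeNine.typeNinePoints =
      Ideal.span {FermatTypeNine.fermatCubic K,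
        FermatTypeNine.formQ (MvPolynomial.X 1) (MvPolynomial.X 2)} ∧
    -- the factorization of `Q(x, y)` into forms of degrees 9, 6, 9
    (∀ x y : MvPolynomial (Fin 3) K, FermatTypeNine.formQ x y =
      (x ^ 9 - 3 * x ^ 6 * y ^ 3 - 6 * x ^ 3 * y ^ 6 - y ^ 9) *
      (x ^ 6 + x ^ 3 * y ^ 3 + y ^ 6) *
      (x ^ 9 + 6 * x ^ 6 * y ^ 3 + 3 * x ^ 3 * y ^ 6 - y ^ 9)) ∧
    -- complete intersection, over `K` and over `ℂ`
    FermatTypeNine.IsCompleteIntersection K FermatTypeNine.typeNinePoints 3 24 ∧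
    FermatTypeNine.IsCompleteIntersection ℂ FermatTypeNine.typeNinePoints 3 24 ∧
    -- `Q(x, y)` splits into 24 linear factors over `K`
    (∃ a b : Fin 24 → K,
      FermatTypeNine.formQ (MvPolynomial.X 0 : MvPolynomial (Fin 3) K) (MvPolynomial.X 1) =
        ∏ i, (MvPolynomial.C (a i) * MvPolynomial.X 0 +
          MvPolynomial.C (b i) * MvPolynomial.X 1)) := by
  have hα' : α ∈ K := hK ▸ IntermediateField.subset_adjoin ℚ _ (Set.mem_insert _ _)
  have hβ' : β ∈ K := hK ▸ IntermediateField.subset_adjoin ℚ _ (Set.mem_insert_of_mem _ rfl)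
  have hβ9 : 1 + β ^ 3 + β ^ 6 = 0 := by
    have h := (hβ.pow (n := 9) (a := 3) (b := 3) (by norm_num) rfl).geom_sum_eq_zero (by norm_num)
    rw [Finset.sum_range_succ, Finset.sum_range_succ, Finset.sum_range_one] at h
    linear_combination h
  obtain ⟨a, rfl⟩ : ∃ a : K, algebraMap K ℂ a = α := ⟨⟨α, hα'⟩, rfl⟩
  obtain ⟨b, rfl⟩ : ∃ b : K, algebraMap K ℂ b = β := ⟨⟨β, hβ'⟩, rfl⟩
  have ha : a ^ 3 = 3 := (algebraMap K ℂ).injective (by rw [map_pow, hα, map_ofNat])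
  have hb : 1 + b ^ 3 + b ^ 6 = 0 := (algebraMap K ℂ).injective (by
    rw [map_add, map_add, map_pow, map_pow, map_one, map_zero, hβ9])
  obtain ⟨τ, hτ⟩ : ∃ τ : Fin 24 → K, FermatTypeNine.IsSplitting τ :=
    ⟨_, FermatTypeNine.isSplitting_rootQ ha (by norm_num) hb⟩
  have hI := FermatTypeNine.idealOfPoints_typeNinePoints hτ
  have h01 : FermatTypeNine.idealOfPoints K
      FermatTypeNine.typeNinePoints = Ideal.span {FermatTypeNine.fermatCubic _,
        FermatTypeNine.formQ (MvPolynomial.X 0) (MvPolynomial.X 1)} :=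
    hI.trans (FermatTypeNine.span_formQ_eq _ (i := 0) (j := 1) (l := 2) rfl).symm
  refine ⟨FermatTypeNine.ncard_typeNinePoints hτ, fun P hP => ?_, h01, ?_, hI,
    FermatTypeNine.formQ_eq_mul, FermatTypeNine.isCompleteIntersection_typeNinePoints hτ,
    FermatTypeNine.isCompleteIntersection_typeNinePoints hτ.map, 1, fun i => -τ i, ?_⟩
  · obtain ⟨i, j, rfl⟩ := FermatTypeNine.exists_coordinates hτ hP
    have h1 : (fun l => ((![τ i, τ j, 1] : Fin 3 → K) l : ℂ)) =
        ![(τ i : ℂ), (τ j : ℂ), 1] := by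
      ext l
      fin_cases l <;> rfl
    refine ⟨![τ i, τ j, 1], h1 ▸ FermatTypeNine.affine_ne_zero _ _, ?_⟩
    simp only [h1]
    rfl
  -- Writing Q(x, y) as Q(y, x) allows the exchange modulo F with the variables in the order y, x,
  -- z.
  · rw [h01, FermatTypeNine.formQ_comm]
    exact FermatTypeNine.span_formQ_eq _ (i := 1) (j := 0) (l := 2)
      (by unfold FermatTypeNine.fermatCubic; ring)
  · rw [hτ.formQ_eq]
    refine Finset.prod_congr rfl fun i _ => ?_
    rw [Pi.one_apply, MvPolynomial.C_1, one_mul, MvPolynomial.C_neg, MvPolynomial.algebraMap_eq]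
    ring
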